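/- Let $\mathfrak g$ be a finite-dimensional simple Lie algebra over $\mathbb C$ with a fixed Cartan subalgebra, simple roots $\alpha_i$, simple coroots $\alpha_i^\vee$ and fundamental weights $\omega_i$ ($i\in I$), Cartan matrix $C_{ij}=\langle\alpha_j,\alpha_i^\vee\rangle$, root system $\Delta=\Delta_+\sqcup\Delta_-$, integral weight lattice $P$, cone $Q^+=\bigoplus_i\mathbb Z_{\ge 0}\alpha_i$ and Weyl group $W$ generated by the simple reflections $s_i$. Let $d_i$ be the relatively prime positive integers with $d_iC_{ij}=d_jC_{ji}$, let $q\in\mathbb C^\times$ not be a root of unity, and put $q_i=q^{d_i}$. Let $\mathcal M$ be the group of Laurent monomials in the variables $Y_{i,a}$ ($i\in I$, $a\in\mathbb C^\times$), let $\omega:\mathcal M\to P$ be the homomorphism with $\omega(Y_{i,a})=\omega_i$, and let $$A_{i,a}=Y_{i,aq_i^{-1}}Y_{i,aq_i}\Big(\prod_{C_{ji}=-1}Y_{j,a}\prod_{C_{ji}=-2}Y_{j,aq^{-1}}Y_{j,aq}\prod_{C_{ji}=-3}Y_{j,aq^{-2}}Y_{j,a}Y_{j,aq^{2}}\Big)^{-1}.$$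 For $w\in W$ let $\widetilde{\mathcal Y}^w$ be the ring of formal series $\sum_{m\in\mathcal M}c_m m$, $c_m\in\mathbb Z$, such that the weights $w(\omega(m))$ with $c_m\ne0$ lie in a finite union of sets $\lambda_k-Q^+$ ($\lambda_k\in P$) and such that for each weight $\mu$ only finitely many $m$ with $\omega(m)=\mu$ have $c_m\neq0$. Let $\Pi=\bigoplus_{w\in W}\widetilde{\mathcal Y}^w$, with componentwise operations. Let $\Sigma^w_{i,a}\in\widetilde{\mathcal Y}^w$ be $$\sum_{k\ge0}\ \prod_{0<j\le k}A^{-1}_{i,aq_i^{-2j+2}}\ \text{ if } w(\alpha_i)\in\Delta_+,\qquad -\sum_{k>0}\ \prod_{0<j\le k}A_{i,aq_i^{2j}}\ \text{ if } w(\alpha_i)\in\Delta_-;$$ it is invertible. Let $\Theta_i^w:\widetilde{\mathcal Y}^w\to\widetilde{\mathcal Y}^{ws_i}$ be given on Laurent monomials by the multiplicative map with $$\Theta_i^w(Y_{j,a})=Y_{j,a}\ (j\ne i),\qquad \Theta_i^w(Y_{i,a})=Y_{i,a}A_{i,aq_i^{-1}}^{-1}\,\frac{\Sigma^{ws_i}_{i,aq_i^{-3}}}{\Sigma^{ws_i}_{i,aq_i^{-1}}},$$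 and on formal series by replacing every monomial by its image, and let $\Theta_i:\Pi\to\Pi$ be the map with components $\Theta_i^w$, $w\in W$. Then the $\Theta_i$, $i\in I$, generate an action of $W$ on $\Pi$ by ring automorphisms, in which $s_i$ acts as $\Theta_i$, and this action is faithful: the homomorphism $W\to\operatorname{Aut}(\Pi)$ is injective. -/

import Mathlib

namespace QWeyl

noncomputable section

open scoped Classical

set_option linter.unusedSectionVars false

variable {ι M N : Type*} [AddCommGroup M] [Module ℂ M] [AddCommGroup N] [Module ℂ N]
  {P : RootPairing ι ℂ M N}

/-! ### Weights -/

/-- The cone `Q⁺` of non-negative integral combinations of the simple roots. -/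
def posCone (b : P.Base) : AddSubmonoid M := AddSubmonoid.closure (P.root '' b.support)

/-- Integral weights: the elements that pair integrally with all coroots. -/
def weightLattice (P : RootPairing ι ℂ M N) : Set M :=
  {x | ∀ i, ∃ n : ℤ, P.toLinearMap x (P.coroot i) = n}

/-- The Cartan matrix in Kac's convention, `C i j = ⟨α_j, α_i^∨⟩`. -/
def cartan [P.IsCrystallographic] (b : P.Base) (i j : b.support) : ℤ := P.pairingIn ℤ j i

/-- The simple reflection `s_i` as an element of the Weyl group. -/
def simpleRefl (b : P.Base) (i : b.support) : P.weylGroup :=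
  RootPairing.weylGroup.ofIdx P (i : ι)

/-- The fundamental weight `ω_i`: the basis of the weight space dual to the simple coroots. -/
def fundWeight [P.IsRootSystem] (b : P.Base) (i : b.support) : M :=
  P.toPerfPair.symm (b.toCoweightBasis.coord i)

/-! ### Monomials -/

/-- The group of Laurent monomials `∏ Y_{i,a}^{u_{i,a}}`, `a ∈ ℂ^×`, written additively: a monomial
is the finitely supported function `(i, a) ↦ u_{i,a}`. -/
abbrev Mono (b : P.Base) : Type _ := (b.support × ℂˣ) →₀ ℤ

/-- The monomial `Y_{i,a}`. -/
def Y (b : P.Base) (i : b.support) (a : ℂˣ) : Mono b := Finsupp.single (i, a) 1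

/-- The weight `ω(m) = ∑ u_{i,a}(m) ω_i` of a monomial. -/
def weight [P.IsRootSystem] (b : P.Base) : Mono b →+ M :=
  Finsupp.liftAddHom fun p => (zmultiplesHom M) (fundWeight b p.1)

/-- The monomial `A_{i,a}` (written additively), where `q_i = q ^ d i`. -/
def A [P.IsCrystallographic] (b : P.Base) (d : b.support → ℕ) (q : ℂˣ) (i : b.support) (a : ℂˣ) :
    Mono b :=
  Y b i (a * (q ^ d i)⁻¹) + Y b i (a * q ^ d i)
    - (∑ j with cartan b j i = -1, Y b j a
      + ∑ j with cartan b j i = -2, (Y b j (a * q⁻¹) + Y b j (a * q))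
      + ∑ j with cartan b j i = -3, (Y b j (a * (q ^ 2)⁻¹) + Y b j a + Y b j (a * q ^ 2)))

/-! ### The completions -/

section Completion

variable [P.IsRootSystem]

/-- The condition on the coefficients of a formal series `∑ c_m m` that defines the completion
attached to `w`: the `w`-twisted weights of the monomials that occur lie in a finite union of cones
`λ - Q⁺`, and only finitely many monomials of each given weight occur. -/
structure Admissible (b : P.Base) (w : P.weylGroup) (c : Mono b → ℤ) : Prop where
  cone : ∃ Λ : Finset M, (∀ μ ∈ Λ, μ ∈ weightLattice P) ∧
    ∀ m, c m ≠ 0 → ∃ μ ∈ Λ, μ - w • weight b m ∈ posCone b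
  fiber : ∀ μ : M, {m | weight b m = μ ∧ c m ≠ 0}.Finite

/-- The completion of the ring of Laurent polynomials attached to `w`: formal series `∑ c_m m` with
admissible coefficients. -/
@[ext] structure Completion (b : P.Base) (w : P.weylGroup) where
  coeff : Mono b → ℤ
  admissible : Admissible b w coeff

/-- Elements of the cone have unique natural coordinates. -/
def coneSum (b : P.Base) (n : b.support → ℕ) : M := ∑ i, n i • P.root i

lemma coneSum_add (b : P.Base) (n k : b.support → ℕ) :
    coneSum b (n + k) = coneSum b n + coneSum b k := by
  simp [coneSum, add_smul, Finset.sum_add_distrib]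

lemma coneSum_injective (b : P.Base) : Function.Injective (coneSum b) := by
  intro n k h
  have h1 := congrArg b.toWeightBasis.repr h
  funext i
  have h2 := DFunLike.congr_fun h1 i
  simp only [coneSum, map_sum, map_nsmul, RootPairing.Base.toWeightBasis_repr_root,
    Finsupp.coe_finsetSum, Finset.sum_apply, Finsupp.smul_apply, Finsupp.single_apply] at h2
  simpa using h2

lemma mem_posCone_iff (b : P.Base) (x : M) : x ∈ posCone b ↔ ∃ n, x = coneSum b n := by
  constructor
  · intro h
    induction h using AddSubmonoid.closure_induction with
    | mem x hx =>
      obtain ⟨i, hi, rfl⟩ := hx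
      refine ⟨Pi.single ⟨i, hi⟩ 1, ?_⟩
      simp [coneSum, Pi.single_apply]
    | zero => exact ⟨0, by simp [coneSum]⟩
    | add x y _ _ hx hy =>
      obtain ⟨n, rfl⟩ := hx
      obtain ⟨k, rfl⟩ := hy
      exact ⟨n + k, (coneSum_add b n k).symm⟩
  · rintro ⟨n, rfl⟩
    refine sum_mem fun i _ => nsmul_mem (AddSubmonoid.subset_closure ?_) _
    exact ⟨(i : ι), i.2, rfl⟩

lemma eq_zero_of_mem_neg_mem (b : P.Base) {x : M} (h : x ∈ posCone b) (h' : -x ∈ posCone b) :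
    x = 0 := by
  obtain ⟨n, rfl⟩ := (mem_posCone_iff b x).1 h
  obtain ⟨k, hk⟩ := (mem_posCone_iff b _).1 h'
  have : coneSum b (n + k) = coneSum b 0 := by
    rw [coneSum_add, ← hk]; simp [coneSum]
  have h0 := coneSum_injective b this
  have : n = 0 := by
    funext i
    have := congrFun h0 i
    simp at this
    simp [this]
  simp [this, coneSum]

/-- Only finitely many weights lie between two given ones. -/
lemma finite_between (b : P.Base) (x : M) :
    {y : M | y ∈ posCone b ∧ x - y ∈ posCone b}.Finite := by
  by_cases hx : ∃ n, x = coneSum b n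
  · obtain ⟨n, rfl⟩ := hx
    refine ((Set.finite_Iic n).image (coneSum b)).subset ?_
    rintro y ⟨hy, hy'⟩
    obtain ⟨k, rfl⟩ := (mem_posCone_iff b _).1 hy
    obtain ⟨l, hl⟩ := (mem_posCone_iff b _).1 hy'
    refine ⟨k, ?_, rfl⟩
    have : n = k + l := coneSum_injective b (by rw [coneSum_add, ← hl]; abel)
    rw [this]
    exact fun i => Nat.le_add_right _ _
  · refine Set.Finite.subset Set.finite_empty ?_
    rintro y ⟨hy, hy'⟩
    refine hx ((mem_posCone_iff b x).1 ?_)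
    simpa using add_mem hy hy'

lemma Admissible.finite_above {b : P.Base} {w : P.weylGroup} {c : Mono b → ℤ}
    (h : Admissible b w c) (x : M) :
    {m | c m ≠ 0 ∧ w • weight b m - x ∈ posCone b}.Finite := by
  obtain ⟨Λ, -, hΛ⟩ := h.cone
  have : (⋃ μ ∈ (Λ : Set M), ⋃ y ∈ {y : M | y ∈ posCone b ∧ (μ - x) - y ∈ posCone b},
      {m | weight b m = w⁻¹ • (y + x) ∧ c m ≠ 0}).Finite :=
    Λ.finite_toSet.biUnion fun μ _ => (finite_between b _).biUnion fun y _ => h.fiber _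
  refine this.subset ?_
  rintro m ⟨hm, hm'⟩
  obtain ⟨μ, hμ, hc⟩ := hΛ m hm
  simp only [Set.mem_iUnion]
  refine ⟨μ, hμ, w • weight b m - x, ⟨hm', by simpa using hc⟩, ?_, hm⟩
  simp

/-! ### The ring structure

The multiplication is the convolution of formal series.  It is imported from Hahn series: the
admissible coefficient functions are exactly the functions whose support is partially well-ordered
for the (reversed) `w`-twisted dominance order on monomials. -/

/-- The monomials, ordered by `m < m'` iff `w ω(m) - w ω(m') ∈ Q⁺ \ {0}`. -/
def OrdMono (b : P.Base) (_w : P.weylGroup) : Type _ := Mono b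

instance (b : P.Base) (w : P.weylGroup) : AddCommGroup (OrdMono b w) :=
  inferInstanceAs (AddCommGroup (Mono b))

/-- A monomial, viewed in the ordered type synonym. -/
def ord (b : P.Base) (w : P.weylGroup) (m : Mono b) : OrdMono b w := m

/-- The strict order relation on monomials. -/
def below (b : P.Base) (w : P.weylGroup) (m m' : Mono b) : Prop :=
  w • weight b m - w • weight b m' ∈ posCone b ∧ weight b m ≠ weight b m'

lemma below_trans {b : P.Base} {w : P.weylGroup} {m m' m'' : Mono b}
    (h : below b w m m') (h' : below b w m' m'') : below b w m m'' := by
  refine ⟨by simpa using add_mem h.1 h'.1, fun e => ?_⟩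
  have h1 := h.1
  rw [e, ← neg_sub] at h1
  have := eq_zero_of_mem_neg_mem b h'.1 h1
  rw [sub_eq_zero] at this
  exact h'.2 (smul_left_cancel _ this)

instance (b : P.Base) (w : P.weylGroup) : PartialOrder (OrdMono b w) where
  le m m' := m = m' ∨ below b w m m'
  lt m m' := below b w m m'
  le_refl m := Or.inl rfl
  le_trans := by
    rintro m m' m'' (rfl | h) (rfl | h')
    · exact Or.inl rfl
    · exact Or.inr h'
    · exact Or.inr h
    · exact Or.inr (below_trans h h')
  le_antisymm := by
    rintro m m' (rfl | h) (h' | h')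
    · rfl
    · rfl
    · exact h'.symm
    · exact absurd rfl (below_trans h h').2
  lt_iff_le_not_ge := by
    intro m m'
    constructor
    · intro h
      refine ⟨Or.inr h, ?_⟩
      rintro (rfl | h')
      · exact h.2 rfl
      · exact (below_trans h h').2 rfl
    · rintro ⟨rfl | h, h'⟩
      · exact absurd (Or.inl rfl) h'
      · exact h

lemma below_add {b : P.Base} {w : P.weylGroup} {m m' : Mono b} (k : Mono b)
    (h : below b w m m') : below b w (k + m) (k + m') := by
  refine ⟨?_, ?_⟩
  · have := h.1
    simp only [map_add, smul_add]
    simpa using this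
  · simpa [map_add] using h.2

lemma below_of_add {b : P.Base} {w : P.weylGroup} {m m' : Mono b} (k : Mono b)
    (h : below b w (k + m) (k + m')) : below b w m m' := by
  simpa using below_add (-k) h

instance (b : P.Base) (w : P.weylGroup) : IsOrderedCancelAddMonoid (OrdMono b w) where
  add_le_add_left := by
    rintro m m' (rfl | h) k
    · exact le_rfl
    · right
      rw [add_comm (m : Mono b) k, add_comm (m' : Mono b) k]
      exact below_add k h
  le_of_add_le_add_left := by
    rintro k m m' (h | h)
    · exact Or.inl (add_left_cancel h)
    · exact Or.inr (below_of_add k h)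

section Integrality

variable [P.IsCrystallographic]

lemma root_mem_weightLattice (j : ι) : P.root j ∈ weightLattice P := fun i =>
  ⟨P.pairingIn ℤ j i, by
    have := P.algebraMap_pairingIn ℤ j i
    simpa using this.symm⟩

lemma smul_mem_weightLattice (w : P.weylGroup) {x : M} (hx : x ∈ weightLattice P) :
    w • x ∈ weightLattice P := by
  obtain ⟨g, hg⟩ := w
  induction hg using RootPairing.weylGroup.induction generalizing x with
  | mem j =>
    intro i
    obtain ⟨n, hn⟩ := hx i
    obtain ⟨k, hk⟩ := hx j
    obtain ⟨l, hl⟩ := root_mem_weightLattice (P := P) j i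
    refine ⟨n - k * l, ?_⟩
    change P.toLinearMap (P.reflection j x) (P.coroot i) = _
    rw [RootPairing.reflection_apply]
    simp [RootPairing.coroot', hn, hk, hl]
  | one => exact hx
  | mul x y hx' hy' h1 h2 =>
    rw [← Submonoid.mk_mul_mk _ _ _ hx' hy', mul_smul]
    exact h1 (h2 hx)

lemma fundWeight_coroot (b : P.Base) (i j : b.support) :
    P.toLinearMap (fundWeight b i) (P.coroot j) = if j = i then 1 else 0 := by
  have : P.toLinearMap (fundWeight b i) = b.toCoweightBasis.coord i := by
    change P.toPerfPair (fundWeight b i) = _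
    simp [fundWeight]
  rw [this, Module.Basis.coord_apply, b.toCoweightBasis_repr_coroot, Finsupp.single_apply]

lemma fundWeight_mem_weightLattice (b : P.Base) (i : b.support) :
    fundWeight b i ∈ weightLattice P := by
  intro k
  have hk := b.coroot_mem_span_int k
  generalize P.coroot k = z at hk ⊢
  induction hk using Submodule.span_induction with
  | mem x hx =>
    obtain ⟨j, hj, rfl⟩ := hx
    have := fundWeight_coroot b i ⟨j, hj⟩
    simp only at this
    rw [this]
    exact ⟨if (⟨j, hj⟩ : b.support) = i then 1 else 0, by push_cast; rfl⟩
  | zero => exact ⟨0, by simp⟩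
  | add x y _ _ hx hy =>
    obtain ⟨n, hn⟩ := hx
    obtain ⟨l, hl⟩ := hy
    exact ⟨n + l, by simp [hn, hl]⟩
  | smul c x _ hx =>
    obtain ⟨n, hn⟩ := hx
    exact ⟨c * n, by simp [hn]⟩

lemma weight_mem_weightLattice (b : P.Base) (m : Mono b) : weight b m ∈ weightLattice P := by
  induction m using Finsupp.induction_linear with
  | zero => exact fun i => ⟨0, by simp⟩
  | add f g hf hg =>
    intro i
    obtain ⟨n, hn⟩ := hf i
    obtain ⟨l, hl⟩ := hg i
    exact ⟨n + l, by simp [hn, hl]⟩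
  | single p u =>
    intro i
    obtain ⟨n, hn⟩ := fundWeight_mem_weightLattice b p.1 i
    exact ⟨u * n, by simp [weight, hn]⟩

end Integrality

/-- A function on monomials is admissible iff its support is partially well-ordered. -/
theorem admissible_iff_isPWO [P.IsCrystallographic] (b : P.Base) (w : P.weylGroup)
    (c : Mono b → ℤ) :
    Admissible b w c ↔ Set.IsPWO {m : OrdMono b w | c m ≠ 0} := by
  constructor
  · intro h
    obtain ⟨Λ, -, hΛ⟩ := h.cone
    have hsub : {m : OrdMono b w | c m ≠ 0} ⊆
        ⋃ μ ∈ Λ, {m : OrdMono b w | c m ≠ 0 ∧ μ - w • weight b m ∈ posCone b} := by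
      intro m hm
      obtain ⟨μ, hμ, hc⟩ := hΛ m hm
      simp only [Set.mem_iUnion]
      exact ⟨μ, hμ, hm, hc⟩
    refine Set.IsPWO.mono ?_ hsub
    refine (Finset.isPWO_bUnion Λ).2 fun μ _ => ?_
    intro f'
    obtain ⟨f, hff⟩ : ∃ f : ℕ → OrdMono b w, ∀ k, f k = (f' k : OrdMono b w) := ⟨_, fun _ => rfl⟩
    have hf : ∀ k, c (f k) ≠ 0 ∧ μ - w • weight b (f k) ∈ posCone b := fun k => by
      rw [hff]; exact (f' k).2
    suffices ∃ k l, k < l ∧ f k ≤ f l by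
      obtain ⟨k, l, hkl, hle⟩ := this
      exact ⟨k, l, hkl, by simpa [hff] using hle⟩
    have hf' : ∀ k, ∃ n, μ - w • weight b (f k) = coneSum b n := fun k =>
      (mem_posCone_iff b _).1 (hf k).2
    choose n hn using hf'
    obtain ⟨g, hg⟩ := (Set.isPWO_of_wellQuasiOrderedLE (Set.univ : Set (b.support → ℕ))).exists_monotone_subseq
      (f := n) (fun k => Set.mem_univ _)
    have key : ∀ k l, k ≤ l → w • weight b (f (g k)) - w • weight b (f (g l)) ∈ posCone b := by
      intro k l hkl
      obtain ⟨e, he⟩ := exists_add_of_le (hg hkl)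
      refine (mem_posCone_iff b _).2 ⟨e, ?_⟩
      have h1 := hn (g l)
      simp only [Function.comp] at he
      rw [he, coneSum_add, ← hn (g k)] at h1
      have : coneSum b e = (μ - w • weight b (f (g l))) - (μ - w • weight b (f (g k))) := by
        rw [h1]; abel
      rw [this]; abel
    by_cases hall : ∃ k l, k < l ∧ weight b (f (g k)) ≠ weight b (f (g l))
    · obtain ⟨k, l, hkl, hne⟩ := hall
      exact ⟨g k, g l, g.strictMono hkl, Or.inr ⟨key k l hkl.le, hne⟩⟩
    · push Not at hall
      have hfin := h.fiber (weight b (f (g 0)))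
      have hmaps : ∀ k, f (g k) ∈ {m | weight b m = weight b (f (g 0)) ∧ c m ≠ 0} := by
        intro k
        refine ⟨?_, (hf _).1⟩
        rcases Nat.eq_zero_or_pos k with rfl | hk
        · rfl
        · exact (hall 0 k hk).symm
      obtain ⟨k, l, hkl, heq⟩ := hfin.exists_lt_map_eq_of_forall_mem hmaps
      exact ⟨g k, g l, g.strictMono hkl, Or.inl heq⟩
  · intro h
    constructor
    · have hanti := setOfPred_minimal_antichain (· ∈ {m : OrdMono b w | c m ≠ 0})
      have hfin : {m : OrdMono b w | Minimal (· ∈ {m : OrdMono b w | c m ≠ 0}) m}.Finite :=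
        hanti.finite_of_partiallyWellOrderedOn (h.mono fun m hm => hm.1)
      refine ⟨hfin.toFinset.image fun m => w • weight b m, ?_, ?_⟩
      · intro μ hμ
        obtain ⟨m, -, rfl⟩ := Finset.mem_image.1 hμ
        exact smul_mem_weightLattice w (weight_mem_weightLattice b m)
      · intro m hm
        obtain ⟨m', hle, hmin⟩ : ∃ m' : OrdMono b w, m' ≤ (show OrdMono b w from m) ∧
            Minimal (· ∈ {m : OrdMono b w | c m ≠ 0}) m' := h.exists_le_minimal hm
        refine ⟨w • weight b m', Finset.mem_image.2 ⟨m', hfin.mem_toFinset.2 hmin, rfl⟩, ?_⟩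
        rcases hle with rfl | hlt
        · simp
        · exact hlt.1
    · intro μ
      have hanti : IsAntichain (fun m m' : OrdMono b w => m ≤ m') {m : OrdMono b w | weight b m = μ ∧ c m ≠ 0} := by
        rintro m ⟨hm, -⟩ m' ⟨hm', -⟩ hne (h | h)
        · exact hne h
        · exact h.2 (hm.trans hm'.symm)
      exact hanti.finite_of_partiallyWellOrderedOn (h.mono fun m hm => hm.2)

/-- A formal series in the completion, viewed as a Hahn series with the same coefficients. -/
def toHahn [P.IsCrystallographic] (b : P.Base) (w : P.weylGroup) :
    Completion b w ≃ HahnSeries (OrdMono b w) ℤ where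
  toFun x := ⟨x.coeff, (admissible_iff_isPWO b w _).1 x.admissible⟩
  invFun x := ⟨x.coeff, (admissible_iff_isPWO b w _).2 x.isPWO_support⟩
  left_inv _ := rfl
  right_inv _ := rfl

instance [P.IsCrystallographic] (b : P.Base) (w : P.weylGroup) : CommRing (Completion b w) :=
  (toHahn b w).commRing

section Ring

variable [P.IsCrystallographic] {b : P.Base} {w : P.weylGroup}

lemma toHahn_mul (x y : Completion b w) : toHahn b w (x * y) = toHahn b w x * toHahn b w y :=
  (toHahn b w).apply_symm_apply _

lemma toHahn_one : toHahn b w 1 = 1 := (toHahn b w).apply_symm_apply _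

lemma toHahn_add (x y : Completion b w) : toHahn b w (x + y) = toHahn b w x + toHahn b w y :=
  (toHahn b w).apply_symm_apply _

/-- Addition is coefficientwise. -/
theorem coeff_add (x y : Completion b w) (n : Mono b) :
    (x + y).coeff n = x.coeff n + y.coeff n :=
  congrArg (fun z : HahnSeries (OrdMono b w) ℤ => z.coeff (ord b w n)) (toHahn_add x y)

/-- Multiplication is convolution (each of these sums has finitely many non-zero terms). -/
theorem coeff_mul (x y : Completion b w) (n : Mono b) :
    (x * y).coeff n = ∑ᶠ k : Mono b, x.coeff k * y.coeff (n - k) := by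
  have h : (x * y).coeff n = (toHahn b w x * toHahn b w y).coeff (ord b w n) :=
    congrArg (fun z : HahnSeries (OrdMono b w) ℤ => z.coeff (ord b w n)) (toHahn_mul x y)
  rw [h, HahnSeries.coeff_mul]
  set S := Finset.antidiagonal (toHahn b w x).isPWO_support (toHahn b w y).isPWO_support n with hS
  have hinj : Set.InjOn (fun p : OrdMono b w × OrdMono b w => p.1) S := by
    rintro ⟨p, r⟩ hp ⟨p', r'⟩ hp' (rfl : p = p')
    have h1 := (Finset.mem_antidiagonal.1 (Finset.mem_coe.1 hp)).2.2
    have h2 := (Finset.mem_antidiagonal.1 (Finset.mem_coe.1 hp')).2.2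
    exact Prod.ext rfl (add_left_cancel (h1.trans h2.symm))
  have hfs := finsum_eq_sum_of_support_subset (s := S.image fun p => p.1)
    (fun k : OrdMono b w => x.coeff k * y.coeff (ord b w n - k : OrdMono b w)) (by
      intro k hk
      have hx := left_ne_zero_of_mul hk
      have hy := right_ne_zero_of_mul hk
      refine Finset.mem_coe.2 (Finset.mem_image.2
        ⟨(k, ord b w n - k), ?_, rfl⟩)
      refine Finset.mem_antidiagonal.2 ⟨hx, hy, ?_⟩
      exact add_sub_cancel k (ord b w n))
  refine Eq.trans ?_ hfs.symm
  rw [Finset.sum_image hinj]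
  refine Finset.sum_congr rfl ?_
  rintro ⟨k, l⟩ hkl
  have h3 : k + l = ord b w n := (Finset.mem_antidiagonal.1 hkl).2.2
  have : l = ord b w n - k := by rw [← h3]; exact (add_sub_cancel_left k l).symm
  subst this
  rfl

lemma exists_ne_of_finsum_ne {α : Type*} {f : α → ℤ} (h : ∑ᶠ k, f k ≠ 0) : ∃ k, f k ≠ 0 := by
  by_contra! hf
  exact h (by simp [hf])

lemma exists_of_coeff_mul_ne_zero {x y : Completion b w} {n : Mono b}
    (h : (x * y).coeff n ≠ 0) : ∃ k, x.coeff k ≠ 0 ∧ y.coeff (n - k) ≠ 0 := by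
  rw [coeff_mul] at h
  obtain ⟨k, hk⟩ := exists_ne_of_finsum_ne h
  exact ⟨k, left_ne_zero_of_mul hk, right_ne_zero_of_mul hk⟩

/-- A monomial as an element of the completion. -/
def monomial (b : P.Base) (w : P.weylGroup) (m : Mono b) : Completion b w :=
  (toHahn b w).symm (HahnSeries.single (ord b w m) 1)

lemma toHahn_monomial (m : Mono b) :
    toHahn b w (monomial b w m) = HahnSeries.single (ord b w m) 1 :=
  (toHahn b w).apply_symm_apply _

theorem coeff_monomial (m n : Mono b) :
    (monomial b w m).coeff n = if n = m then 1 else 0 := by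
  change (HahnSeries.single (ord b w m) (1 : ℤ)).coeff (ord b w n) = _
  rw [HahnSeries.coeff_single]
  exact if_congr Iff.rfl rfl rfl

lemma monomial_mul (m n : Mono b) :
    monomial b w m * monomial b w n = monomial b w (m + n) := by
  apply (toHahn b w).injective
  rw [toHahn_mul, toHahn_monomial, toHahn_monomial, toHahn_monomial,
    HahnSeries.single_mul_single, one_mul]
  rfl

lemma monomial_zero : monomial b w 0 = 1 := by
  apply (toHahn b w).injective
  rw [toHahn_monomial, toHahn_one]
  rfl

/-- A monomial as an invertible element of the completion. -/
def monoUnit (b : P.Base) (w : P.weylGroup) (m : Mono b) : (Completion b w)ˣ where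
  val := monomial b w m
  inv := monomial b w (-m)
  val_inv := by rw [monomial_mul, add_neg_cancel, monomial_zero]
  inv_val := by rw [monomial_mul, neg_add_cancel, monomial_zero]

/-- All monomials of `x` have `w`-twisted weight at most that of `μ`. -/
def WBdd (b : P.Base) (w : P.weylGroup) (μ : M) (x : Completion b w) : Prop :=
  ∀ n, x.coeff n ≠ 0 → w • (μ - weight b n) ∈ posCone b

lemma WBdd.mul {μ ν : M} {x y : Completion b w} (hx : WBdd b w μ x) (hy : WBdd b w ν y) :
    WBdd b w (μ + ν) (x * y) := by
  intro n hn
  obtain ⟨k, hk, hk'⟩ := exists_of_coeff_mul_ne_zero hn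
  have := add_mem (hx k hk) (hy _ hk')
  rw [← smul_add, map_sub] at this
  convert this using 2
  abel

lemma WBdd.monomial (m : Mono b) : WBdd b w (weight b m) (monomial b w m) := by
  intro n hn
  rw [coeff_monomial] at hn
  have : n = m := by by_contra h; simp [h] at hn
  simp [this]

/-- The unit `u` and its inverse are bounded by `μ` and `-μ`. -/
def UBdd (b : P.Base) (w : P.weylGroup) (μ : M) (u : (Completion b w)ˣ) : Prop :=
  WBdd b w μ u ∧ WBdd b w (-μ) (u⁻¹ : (Completion b w)ˣ)

lemma UBdd.mul {μ ν : M} {x y : (Completion b w)ˣ} (hx : UBdd b w μ x) (hy : UBdd b w ν y) :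
    UBdd b w (μ + ν) (x * y) := by
  refine ⟨by rw [Units.val_mul]; exact hx.1.mul hy.1, ?_⟩
  rw [mul_inv, Units.val_mul, neg_add]
  exact hx.2.mul hy.2

lemma UBdd.inv {μ : M} {x : (Completion b w)ˣ} (hx : UBdd b w μ x) : UBdd b w (-μ) x⁻¹ :=
  ⟨hx.2, by rw [inv_inv, neg_neg]; exact hx.1⟩

lemma UBdd.mono (m : Mono b) : UBdd b w (weight b m) (monoUnit b w m) :=
  ⟨WBdd.monomial m, by rw [← map_neg]; exact WBdd.monomial (-m)⟩

lemma UBdd.one : UBdd b w 0 (1 : (Completion b w)ˣ) := by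
  have h : (1 : (Completion b w)ˣ) = monoUnit b w 0 := Units.ext monomial_zero.symm
  have := UBdd.mono (b := b) (w := w) 0
  rwa [map_zero, ← h] at this

lemma UBdd.zpow {μ : M} {x : (Completion b w)ˣ} (hx : UBdd b w μ x) (n : ℤ) :
    UBdd b w (n • μ) (x ^ n) := by
  have hnat : ∀ k : ℕ, UBdd b w (k • μ) (x ^ k) := by
    intro k
    induction k with
    | zero => simpa using UBdd.one
    | succ k ih => rw [pow_succ, succ_nsmul]; exact ih.mul hx
  obtain ⟨k, rfl | rfl⟩ := n.eq_nat_or_neg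
  · simpa using hnat k
  · simpa using (hnat k).inv

lemma UBdd.prod {α : Type*} (s : Finset α) {μ : α → M} {x : α → (Completion b w)ˣ}
    (h : ∀ j ∈ s, UBdd b w (μ j) (x j)) : UBdd b w (∑ j ∈ s, μ j) (∏ j ∈ s, x j) := by
  induction s using Finset.induction_on with
  | empty => simpa using UBdd.one
  | insert j s hj ih =>
    rw [Finset.sum_insert hj, Finset.prod_insert hj]
    exact (h j (Finset.mem_insert_self _ _)).mul
      (ih fun k hk => h k (Finset.mem_insert_of_mem hk))

end Ring

/-- Geometric series in a Hahn series ring over a partially ordered group. -/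
lemma exists_inv_one_sub {Γ : Type*} [AddCommGroup Γ] [PartialOrder Γ] [IsOrderedCancelAddMonoid Γ]
    (x : HahnSeries Γ ℤ) (hx : ∀ m ∈ x.support, 0 < m) :
    ∃ g : HahnSeries Γ ℤ, (1 - x) * g = 1 ∧ ∀ m ∈ g.support, 0 ≤ m := by
  have hcl : ((AddSubmonoid.closure x.support : AddSubmonoid Γ) : Set Γ).IsPWO :=
    x.isPWO_support.addSubmonoid_closure fun m hm => (hx m hm).le
  have hpwo : Set.IsPWO (⋃ n, HahnSeries.support (x ^ n)) :=
    hcl.mono (Set.iUnion_subset fun n =>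
      HahnSeries.SummableFamily.support_pow_subset_closure x n)
  have hfin : ∀ g : Γ, Set.Finite {a : ℕ | (x ^ a).coeff g ≠ 0} := by
    intro g
    by_cases hg : g ∈ ⋃ n : ℕ, HahnSeries.support (x ^ n)
    swap; · exact Set.finite_empty.subset fun n hn => hg (Set.mem_iUnion.2 ⟨n, hn⟩)
    apply hpwo.isWF.induction hg
    intro y ys hy
    refine ((((Finset.antidiagonal x.isPWO_support hpwo y).finite_toSet.biUnion
      fun ij hij => hy ij.snd (Finset.mem_antidiagonal.1 (Finset.mem_coe.1 hij)).2.1 ?_).image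
        Nat.succ).union (Set.finite_singleton 0)).subset ?_
    · obtain ⟨hi, _, rfl⟩ := Finset.mem_antidiagonal.1 (Finset.mem_coe.1 hij)
      exact lt_add_of_pos_left ij.2 (hx _ hi)
    · rintro (_ | n) hn
      · exact Set.mem_union_right _ (Set.mem_singleton 0)
      · have hn' : y ∈ HahnSeries.support (x ^ (n + 1)) := hn
        rw [pow_succ] at hn'
        obtain ⟨i, hi, j, hj, rfl⟩ := HahnSeries.support_mul_subset hn'
        refine Set.mem_union_left _ ⟨n, Set.mem_iUnion.2 ⟨⟨j, i⟩, Set.mem_iUnion.2 ⟨?_, hi⟩⟩, rfl⟩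
        exact Finset.mem_coe.2 (Finset.mem_antidiagonal.2
          ⟨hj, Set.mem_iUnion.2 ⟨n, hi⟩, add_comm j i⟩)
  let s : HahnSeries.SummableFamily Γ ℤ ℕ :=
    { toFun := fun n => x ^ n
      isPWO_iUnion_support' := hpwo
      finite_co_support' := hfin }
  have hs : ∀ n, s n = x ^ n := fun _ => rfl
  have hemb : (x • s).embDomain ⟨Nat.succ, Nat.succ_injective⟩ =
      s - HahnSeries.SummableFamily.ofFinsupp (Finsupp.single 0 1) := by
    apply HahnSeries.SummableFamily.ext
    rintro (_ | n)
    · rw [HahnSeries.SummableFamily.embDomain_of_notMem_range]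
      · simp [hs]
      · simp
    · have := HahnSeries.SummableFamily.embDomain_image (s := x • s)
        (f := ⟨Nat.succ, Nat.succ_injective⟩) (a := n)
      refine this.trans ?_
      simp [hs, HahnSeries.of_symm_smul_of_eq_mul, pow_succ', -smul_eq_mul]
  refine ⟨s.hsum, ?_, ?_⟩
  · rw [← HahnSeries.SummableFamily.hsum_smul, sub_smul 1 x s, one_smul,
      HahnSeries.SummableFamily.hsum_sub,
      ← HahnSeries.SummableFamily.hsum_embDomain (x • s) ⟨Nat.succ, Nat.succ_injective⟩, hemb]
    simp
  · intro m hm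
    have h1 := HahnSeries.SummableFamily.support_hsum_subset hm
    obtain ⟨n, hn⟩ := Set.mem_iUnion.1 h1
    have h2 := HahnSeries.SummableFamily.support_pow_subset_closure x n hn
    exact AddSubmonoid.closure_induction (motive := fun z _ => 0 ≤ z) (fun z hz => (hx z hz).le)
      le_rfl (fun y z _ _ hy hz => add_nonneg hy hz) h2

section Lead

variable [P.IsCrystallographic] {b : P.Base} {w : P.weylGroup}

/-- A series with leading coefficient `±1` at a unique monomial of highest weight is invertible. -/
lemma exists_unit (x : Completion b w) (m₀ : Mono b) (ε : ℤ) (hε : ε * ε = 1)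
    (h0 : x.coeff m₀ = ε) (h : ∀ m, x.coeff m ≠ 0 → m ≠ m₀ → below b w m₀ m) :
    ∃ u : (Completion b w)ˣ, (u : Completion b w) = x ∧ UBdd b w (weight b m₀) u := by
  set X := toHahn b w x with hX
  have hXc : ∀ m, X.coeff m = x.coeff m := fun _ => rfl
  set L : HahnSeries (OrdMono b w) ℤ := HahnSeries.single (-ord b w m₀) ε with hL
  have hLX : ∀ m, (L * X).coeff m = ε * X.coeff (m + ord b w m₀) := by
    intro m
    have := HahnSeries.coeff_single_mul_add (r := ε) (x := X) (a := m + ord b w m₀)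
      (b := -ord b w m₀)
    rwa [add_neg_cancel_right] at this
  obtain ⟨g, hg, hg0⟩ := exists_inv_one_sub (1 - L * X) (by
    intro m hm
    rw [HahnSeries.mem_support, HahnSeries.coeff_sub, hLX] at hm
    have hm0 : m ≠ 0 := by
      rintro rfl
      apply hm
      rw [zero_add, hXc]
      change HahnSeries.coeff 1 0 - ε * x.coeff m₀ = 0
      rw [h0, hε]
      simp
    have hx : x.coeff (m + ord b w m₀) ≠ 0 := by
      intro hx
      apply hm
      rw [hXc, hx]
      simp [HahnSeries.coeff_one, hm0]
    have hb : ord b w m₀ < m + ord b w m₀ := h _ hx (by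
      intro e
      apply hm0
      have e' : m + ord b w m₀ = ord b w m₀ := e
      simpa using e')
    simpa using hb)
  rw [sub_sub_cancel] at hg
  have hLg : ∀ m, (L * g).coeff m = ε * g.coeff (m + ord b w m₀) := by
    intro m
    have := HahnSeries.coeff_single_mul_add (r := ε) (x := g) (a := m + ord b w m₀)
      (b := -ord b w m₀)
    rwa [add_neg_cancel_right] at this
  have hmul : x * (toHahn b w).symm (L * g) = 1 := by
    apply (toHahn b w).injective
    rw [toHahn_mul, toHahn_one, Equiv.apply_symm_apply, ← hX, ← hg]
    ring
  refine ⟨⟨x, (toHahn b w).symm (L * g), hmul, by rw [mul_comm]; exact hmul⟩, rfl, ?_, ?_⟩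
  · intro n hn
    by_cases e : n = m₀
    · simp [e]
    · have := (h n hn e).1
      rwa [smul_sub]
  · intro n hn
    have hn' : (L * g).coeff (ord b w n) ≠ 0 := hn
    rw [hLg] at hn'
    have hle : 0 ≤ ord b w n + ord b w m₀ := hg0 _ (right_ne_zero_of_mul hn')
    rcases hle with heq | hlt
    · have : weight b (n + m₀) = 0 := by
        rw [show n + m₀ = 0 from heq.symm, map_zero]
      rw [map_add] at this
      have h2 : -weight b m₀ - weight b n = 0 := by
        rw [← neg_eq_zero, ← this]; abel
      rw [h2, smul_zero]
      exact zero_mem _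
    · have h1 := hlt.1
      have h2 : w • weight b (0 : Mono b) - w • weight b (n + m₀) ∈ posCone b := h1
      rw [← smul_sub, map_zero, map_add] at h2
      convert h2 using 2
      abel

end Lead

/-! ### The series `Σ_{i,a}` -/

section Sigma

variable [P.IsCrystallographic]

/-- The monomial `∏_{0 < j ≤ k} A_{i, a q_i^{-2j+2}}^{-1}`. -/
def V (b : P.Base) (d : b.support → ℕ) (q : ℂˣ) (i : b.support) (a : ℂˣ) (k : ℕ) : Mono b :=
  ∑ j ∈ Finset.Icc 1 k, -A b d q i (a * (q ^ d i) ^ (-2 * (j : ℤ) + 2))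

/-- The monomial `∏_{0 < j ≤ k} A_{i, a q_i^{2j}}`. -/
def U (b : P.Base) (d : b.support → ℕ) (q : ℂˣ) (i : b.support) (a : ℂˣ) (k : ℕ) : Mono b :=
  ∑ j ∈ Finset.Icc 1 k, A b d q i (a * (q ^ d i) ^ (2 * (j : ℤ)))

/-- Coefficients of `Σ^+_{i,a} = ∑_{k ≥ 0} ∏_{0 < j ≤ k} A_{i, a q_i^{-2j+2}}^{-1}`. -/
def sigmaPlus (b : P.Base) (d : b.support → ℕ) (q : ℂˣ) (i : b.support) (a : ℂˣ) :
    Mono b → ℤ :=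
  fun m => ∑ᶠ k : ℕ, if m = V b d q i a k then 1 else 0

/-- Coefficients of `Σ^-_{i,a} = -∑_{k > 0} ∏_{0 < j ≤ k} A_{i, a q_i^{2j}}`. -/
def sigmaMinus (b : P.Base) (d : b.support → ℕ) (q : ℂˣ) (i : b.support) (a : ℂˣ) :
    Mono b → ℤ :=
  fun m => -∑ᶠ k : ℕ, if 0 < k ∧ m = U b d q i a k then 1 else 0

/-- Coefficients of `Σ^w_{i,a}`: this is `Σ^+_{i,a}` if the root `w(α_i)` is positive and
`Σ^-_{i,a}` otherwise. -/
def sigmaCoeff (b : P.Base) (d : b.support → ℕ) (q : ℂˣ) (w : P.weylGroup) (i : b.support)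
    (a : ℂˣ) : Mono b → ℤ :=
  if w • P.root i ∈ posCone b then sigmaPlus b d q i a else sigmaMinus b d q i a

lemma smul_nsmul (w : P.weylGroup) (k : ℕ) (x : M) : w • (k • x) = k • (w • x) :=
  (DistribSMul.toAddMonoidHom M w).map_nsmul k x

lemma smul_zsmul (w : P.weylGroup) (k : ℤ) (x : M) : w • (k • x) = k • (w • x) :=
  (DistribSMul.toAddMonoidHom M w).map_zsmul k x

lemma smul_root_pos_or_neg (b : P.Base) (w : P.weylGroup) (i : ι) :
    w • P.root i ∈ posCone b ∨ -(w • P.root i) ∈ posCone b := by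
  rw [RootPairing.weylGroup_apply_root]
  exact b.root_mem_or_neg_mem _

lemma weight_Y (b : P.Base) (i : b.support) (a : ℂˣ) : weight b (Y b i a) = fundWeight b i := by
  simp [weight, Y]

variable [Finite ι]

/-- `A_{i,a}` has weight `α_i`. -/
theorem weight_A (b : P.Base) (d : b.support → ℕ) (q : ℂˣ) (i : b.support) (a : ℂˣ) :
    weight b (A b d q i a) = P.root i := by
  apply P.toPerfPair.injective
  apply b.toCoweightBasis.ext
  intro k
  rw [b.toCoweightBasis_apply]
  change P.toLinearMap (weight b (A b d q i a)) (P.coroot k) = P.toLinearMap (P.root i) (P.coroot k)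
  have hp : P.toLinearMap (P.root i) (P.coroot k) = (cartan b k i : ℂ) := by
    have := P.algebraMap_pairingIn ℤ (i : ι) (k : ι)
    simpa [cartan] using this.symm
  rw [hp]
  simp only [A, map_sub, map_add, map_sum, weight_Y, LinearMap.sub_apply, LinearMap.add_apply,
    LinearMap.sum_apply, fundWeight_coroot, Finset.sum_add_distrib, Finset.sum_ite_eq,
    Finset.mem_filter, Finset.mem_univ, true_and]
  by_cases hki : k = i
  · subst hki
    have : cartan b k k = 2 := b.cartanMatrix_apply_same k
    simp [this]
    norm_num
  · have h : cartan b k i ∈ ({-3, -2, -1, 0} : Set ℤ) :=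
      b.cartanMatrix_mem_of_ne (i := i) (j := k) (Ne.symm hki)
    simp only [Set.mem_insert_iff, Set.mem_singleton_iff] at h
    rcases h with h | h | h | h <;> simp [h, hki] <;> norm_num

lemma weight_V (b : P.Base) (d : b.support → ℕ) (q : ℂˣ) (i : b.support) (a : ℂˣ) (k : ℕ) :
    weight b (V b d q i a k) = -(k • P.root i) := by
  simp [V, weight_A]

lemma weight_U (b : P.Base) (d : b.support → ℕ) (q : ℂˣ) (i : b.support) (a : ℂˣ) (k : ℕ) :
    weight b (U b d q i a k) = k • P.root i := by
  simp [U, weight_A]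

lemma nsmul_root_injective (P : RootPairing ι ℂ M N) (i : ι) :
    Function.Injective fun k : ℕ => k • P.root i := by
  intro k l h
  simp only at h
  rw [← Nat.cast_smul_eq_nsmul ℂ, ← Nat.cast_smul_eq_nsmul ℂ] at h
  exact_mod_cast smul_left_injective ℂ (P.ne_zero i) h

lemma exists_of_sigmaPlus_ne {b : P.Base} {d : b.support → ℕ} {q : ℂˣ} {i : b.support} {a : ℂˣ}
    {m : Mono b} (h : sigmaPlus b d q i a m ≠ 0) : ∃ k, m = V b d q i a k := by
  obtain ⟨k, hk⟩ := exists_ne_of_finsum_ne h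
  exact ⟨k, by by_contra hc; simp [hc] at hk⟩

lemma exists_of_sigmaMinus_ne {b : P.Base} {d : b.support → ℕ} {q : ℂˣ} {i : b.support} {a : ℂˣ}
    {m : Mono b} (h : sigmaMinus b d q i a m ≠ 0) : ∃ k, 0 < k ∧ m = U b d q i a k := by
  obtain ⟨k, hk⟩ := exists_ne_of_finsum_ne (neg_ne_zero.1 h)
  exact ⟨k, by by_contra hc; simp [hc] at hk⟩

lemma sigma_admissible (b : P.Base) (d : b.support → ℕ) (q : ℂˣ) (w : P.weylGroup)
    (i : b.support) (a : ℂˣ) : Admissible b w (sigmaCoeff b d q w i a) := by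
  have hinj := nsmul_root_injective P (i : ι)
  unfold sigmaCoeff
  split_ifs with hw
  · refine ⟨⟨{0}, ?_, ?_⟩, ?_⟩
    · simp only [Finset.mem_singleton, forall_eq]
      exact fun i => ⟨0, by simp⟩
    · intro m hm
      obtain ⟨k, rfl⟩ := exists_of_sigmaPlus_ne hm
      refine ⟨0, Finset.mem_singleton_self _, ?_⟩
      rw [weight_V, smul_neg, zero_sub, neg_neg, smul_nsmul]
      exact nsmul_mem hw k
    · intro μ
      refine Set.Subsingleton.finite ?_
      rintro m ⟨hm, hm'⟩ n ⟨hn, hn'⟩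
      obtain ⟨k, rfl⟩ := exists_of_sigmaPlus_ne hm'
      obtain ⟨l, rfl⟩ := exists_of_sigmaPlus_ne hn'
      rw [← hn, weight_V, weight_V] at hm
      rw [hinj (neg_injective hm)]
  · refine ⟨⟨{0}, ?_, ?_⟩, ?_⟩
    · simp only [Finset.mem_singleton, forall_eq]
      exact fun i => ⟨0, by simp⟩
    · intro m hm
      obtain ⟨k, -, rfl⟩ := exists_of_sigmaMinus_ne hm
      refine ⟨0, Finset.mem_singleton_self _, ?_⟩
      rw [weight_U, zero_sub, smul_nsmul, ← smul_neg]
      exact nsmul_mem ((smul_root_pos_or_neg b w i).resolve_left hw) k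
    · intro μ
      refine Set.Subsingleton.finite ?_
      rintro m ⟨hm, hm'⟩ n ⟨hn, hn'⟩
      obtain ⟨k, -, rfl⟩ := exists_of_sigmaMinus_ne hm'
      obtain ⟨l, -, rfl⟩ := exists_of_sigmaMinus_ne hn'
      rw [← hn, weight_U, weight_U] at hm
      rw [hinj hm]

/-- The element `Σ^w_{i,a}` of the completion attached to `w`. -/
def sigma (b : P.Base) (d : b.support → ℕ) (q : ℂˣ) (w : P.weylGroup) (i : b.support) (a : ℂˣ) :
    Completion b w :=
  ⟨sigmaCoeff b d q w i a, sigma_admissible b d q w i a⟩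

/-- The weight of the highest term of `Σ^w_{i,a}`. -/
def sigmaWeight (b : P.Base) (w : P.weylGroup) (i : b.support) : M :=
  if w • P.root i ∈ posCone b then 0 else P.root i

/-- `Σ^w_{i,a}` is invertible. -/
lemma exists_sigma_unit (b : P.Base) (d : b.support → ℕ) (q : ℂˣ) (w : P.weylGroup)
    (i : b.support) (a : ℂˣ) :
    ∃ u : (Completion b w)ˣ, (u : Completion b w) = sigma b d q w i a ∧
      UBdd b w (sigmaWeight b w i) u := by
  have hinj := nsmul_root_injective P (i : ι)
  by_cases hw : w • P.root i ∈ posCone b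
  · obtain ⟨u, hu, hu'⟩ := exists_unit (sigma b d q w i a) (V b d q i a 0) 1 rfl
      (by
        change sigmaCoeff b d q w i a _ = 1
        rw [sigmaCoeff, if_pos hw, sigmaPlus, finsum_eq_single _ 0]
        · simp
        · intro k hk
          rw [if_neg]
          intro e
          have := congrArg (weight b) e
          rw [weight_V, weight_V] at this
          exact hk (hinj (neg_injective this)).symm)
      (by
        intro m hm hne
        change sigmaCoeff b d q w i a _ ≠ 0 at hm
        rw [sigmaCoeff, if_pos hw] at hm
        obtain ⟨k, rfl⟩ := exists_of_sigmaPlus_ne hm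
        refine ⟨?_, fun e => hne ?_⟩
        · rw [weight_V, weight_V, ← smul_sub]
          simp only [zero_smul, neg_zero, zero_sub, neg_neg]
          rw [smul_nsmul]
          exact nsmul_mem hw k
        · rw [weight_V, weight_V] at e
          rw [hinj (neg_injective e)])
    refine ⟨u, hu, ?_⟩
    rw [weight_V, zero_smul, neg_zero] at hu'
    rwa [sigmaWeight, if_pos hw]
  · obtain ⟨u, hu, hu'⟩ := exists_unit (sigma b d q w i a) (U b d q i a 1) (-1) rfl
      (by
        change sigmaCoeff b d q w i a _ = -1
        rw [sigmaCoeff, if_neg hw, sigmaMinus, finsum_eq_single _ 1]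
        · simp
        · intro k hk
          rw [if_neg]
          rintro ⟨-, e⟩
          have := congrArg (weight b) e
          rw [weight_U, weight_U] at this
          exact hk (hinj this).symm)
      (by
        intro m hm hne
        change sigmaCoeff b d q w i a _ ≠ 0 at hm
        rw [sigmaCoeff, if_neg hw] at hm
        obtain ⟨k, hk, rfl⟩ := exists_of_sigmaMinus_ne hm
        refine ⟨?_, fun e => hne ?_⟩
        · obtain ⟨l, rfl⟩ := Nat.exists_eq_add_of_le hk
          rw [weight_U, weight_U, add_smul, smul_add]
          have := nsmul_mem ((smul_root_pos_or_neg b w i).resolve_left hw) l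
          simpa [smul_nsmul] using this
        · rw [weight_U, weight_U] at e
          rw [hinj e])
    refine ⟨u, hu, ?_⟩
    rw [weight_U, one_smul] at hu'
    rwa [sigmaWeight, if_neg hw]

lemma isUnit_sigma (b : P.Base) (d : b.support → ℕ) (q : ℂˣ) (w : P.weylGroup)
    (i : b.support) (a : ℂˣ) : IsUnit (sigma b d q w i a) := by
  obtain ⟨u, hu, -⟩ := exists_sigma_unit b d q w i a
  exact ⟨u, hu⟩

/-- `Σ^w_{i,a}` as an invertible element. -/
def sigmaUnit (b : P.Base) (d : b.support → ℕ) (q : ℂˣ) (w : P.weylGroup) (i : b.support)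
    (a : ℂˣ) : (Completion b w)ˣ :=
  (isUnit_sigma b d q w i a).unit

lemma uBdd_sigmaUnit (b : P.Base) (d : b.support → ℕ) (q : ℂˣ) (w : P.weylGroup)
    (i : b.support) (a : ℂˣ) : UBdd b w (sigmaWeight b w i) (sigmaUnit b d q w i a) := by
  obtain ⟨u, hu, hu'⟩ := exists_sigma_unit b d q w i a
  have : sigmaUnit b d q w i a = u := Units.ext hu.symm
  rwa [this]

/-! ### The operators `Θ_i` -/

/-- The image `Θ_i^{v s_i}(Y_{j,a})`, an invertible element of the completion attached to `v`.
It is `Y_{j,a}` for `j ≠ i`, and `Y_{i,a} A_{i,a q_i^{-1}}^{-1} Σ^v_{i,a q_i^{-3}} /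
Σ^v_{i,a q_i^{-1}}` for `j = i`. -/
def thetaVar (b : P.Base) (d : b.support → ℕ) (q : ℂˣ) (i : b.support) (v : P.weylGroup)
    (j : b.support) (a : ℂˣ) : (Completion b v)ˣ :=
  if j = i then
    monoUnit b v (Y b i a) * (monoUnit b v (A b d q i (a * (q ^ d i)⁻¹)))⁻¹ *
      (sigmaUnit b d q v i (a * ((q ^ d i) ^ 3)⁻¹) / sigmaUnit b d q v i (a * (q ^ d i)⁻¹))
  else monoUnit b v (Y b j a)

/-- The image of a Laurent monomial `∏ Y_{j,a}^{u_{j,a}}` under the ring homomorphism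
`Θ_i^{v s_i}` determined by `thetaVar`. -/
def thetaMono (b : P.Base) (d : b.support → ℕ) (q : ℂˣ) (i : b.support) (v : P.weylGroup)
    (m : Mono b) : (Completion b v)ˣ :=
  m.prod fun p u => thetaVar b d q i v p.1 p.2 ^ u

lemma simpleRefl_smul_fundWeight (b : P.Base) (i j : b.support) :
    simpleRefl b i • fundWeight b j = if j = i then fundWeight b j - P.root i
      else fundWeight b j := by
  change P.reflection i (fundWeight b j) = _
  rw [RootPairing.reflection_apply]
  simp only [RootPairing.coroot', LinearMap.flip_apply, fundWeight_coroot]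
  by_cases h : j = i
  · subst h; simp
  · simp [h, Ne.symm h]

lemma uBdd_thetaVar (b : P.Base) (d : b.support → ℕ) (q : ℂˣ) (i : b.support) (v : P.weylGroup)
    (j : b.support) (a : ℂˣ) :
    UBdd b v (simpleRefl b i • fundWeight b j) (thetaVar b d q i v j a) := by
  rw [simpleRefl_smul_fundWeight, thetaVar]
  split_ifs with h
  · subst h
    have h1 := ((UBdd.mono (w := v) (Y b j a)).mul
      (UBdd.mono (w := v) (A b d q j (a * (q ^ d j)⁻¹))).inv).mul
      ((uBdd_sigmaUnit b d q v j (a * ((q ^ d j) ^ 3)⁻¹)).mul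
        (uBdd_sigmaUnit b d q v j (a * (q ^ d j)⁻¹)).inv)
    rw [weight_Y, weight_A, add_neg_cancel, add_zero, ← sub_eq_add_neg] at h1
    rwa [div_eq_mul_inv]
  · have h1 := UBdd.mono (w := v) (Y b j a)
    rwa [weight_Y] at h1

lemma uBdd_thetaMono (b : P.Base) (d : b.support → ℕ) (q : ℂˣ) (i : b.support) (v : P.weylGroup)
    (m : Mono b) : UBdd b v (simpleRefl b i • weight b m) (thetaMono b d q i v m) := by
  have h : simpleRefl b i • weight b m =
      ∑ p ∈ m.support, m p • (simpleRefl b i • fundWeight b p.1) := by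
    simp [weight, Finsupp.sum, Finset.smul_sum, smul_zsmul]
  rw [h]
  exact UBdd.prod _ fun p _ => (uBdd_thetaVar b d q i v p.1 p.2).zpow _

/-- A monomial of `Θ_i(m)` has `v`-twisted weight at most the `v s_i`-twisted weight of `m`. -/
lemma thetaMono_bound {b : P.Base} {d : b.support → ℕ} {q : ℂˣ} {i : b.support} {v : P.weylGroup}
    {m n : Mono b} (h : (thetaMono b d q i v m : Completion b v).coeff n ≠ 0) :
    (v * simpleRefl b i) • weight b m - v • weight b n ∈ posCone b := by
  have := (uBdd_thetaMono b d q i v m).1 n h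
  rwa [smul_sub, ← mul_smul] at this

/-- Coefficients of the series `∑ x_m Θ_i(m)` obtained from `x = ∑ x_m m` by replacing each
monomial by its image. -/
def thetaCoeff (b : P.Base) (d : b.support → ℕ) (q : ℂˣ) (i : b.support) (v : P.weylGroup)
    (x : Completion b (v * simpleRefl b i)) (n : Mono b) : ℤ :=
  ∑ᶠ m : Mono b, x.coeff m * (thetaMono b d q i v m : Completion b v).coeff n

/-- Each coefficient of `∑ x_m Θ_i(m)` is a finite sum. -/
theorem theta_finite (b : P.Base) (d : b.support → ℕ) (q : ℂˣ) (i : b.support) (v : P.weylGroup)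
    (x : Completion b (v * simpleRefl b i)) (n : Mono b) :
    {m | x.coeff m * (thetaMono b d q i v m : Completion b v).coeff n ≠ 0}.Finite := by
  refine (x.admissible.finite_above (v • weight b n)).subset ?_
  intro m hm
  exact ⟨left_ne_zero_of_mul hm, thetaMono_bound (right_ne_zero_of_mul hm)⟩

lemma theta_admissible (b : P.Base) (d : b.support → ℕ) (q : ℂˣ) (i : b.support)
    (v : P.weylGroup) (x : Completion b (v * simpleRefl b i)) :
    Admissible b v (thetaCoeff b d q i v x) := by
  constructor
  · obtain ⟨Λ, hΛ, hc⟩ := x.admissible.cone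
    refine ⟨Λ, hΛ, fun n hn => ?_⟩
    obtain ⟨m, hm⟩ := exists_ne_of_finsum_ne hn
    obtain ⟨μ, hμ, hmem⟩ := hc m (left_ne_zero_of_mul hm)
    refine ⟨μ, hμ, ?_⟩
    simpa using add_mem hmem (thetaMono_bound (right_ne_zero_of_mul hm))
  · intro μ
    refine Set.Finite.subset ((x.admissible.finite_above (v • μ)).biUnion fun m _ =>
      (thetaMono b d q i v m : Completion b v).admissible.fiber μ) ?_
    rintro n ⟨rfl, hn⟩
    obtain ⟨m, hm⟩ := exists_ne_of_finsum_ne hn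
    simp only [Set.mem_iUnion]
    exact ⟨m, ⟨left_ne_zero_of_mul hm, thetaMono_bound (right_ne_zero_of_mul hm)⟩, rfl,
      right_ne_zero_of_mul hm⟩

/-- The component of `Θ_i` that maps the completion attached to `v s_i` to the one attached
to `v = (v s_i) s_i`. -/
def thetaComponent (b : P.Base) (d : b.support → ℕ) (q : ℂˣ) (i : b.support) (v : P.weylGroup)
    (x : Completion b (v * simpleRefl b i)) : Completion b v :=
  ⟨thetaCoeff b d q i v x, theta_admissible b d q i v x⟩

/-- The ring `Π`: the direct sum of the completions attached to the elements `w` of the (finite)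
Weyl group, with componentwise operations. -/
abbrev BigPi (b : P.Base) : Type _ := ∀ w : P.weylGroup, Completion b w

/-- The operator `Θ_i : Π → Π`; its components are the extensions of the homomorphisms given by
`thetaVar` on Laurent polynomials to formal series, by replacing every monomial of a series by its
image. -/
def Theta (b : P.Base) (d : b.support → ℕ) (q : ℂˣ) (i : b.support) (x : BigPi b) : BigPi b :=
  fun v => thetaComponent b d q i v (x (v * simpleRefl b i))

theorem thetaMono_Y (b : P.Base) (d : b.support → ℕ) (q : ℂˣ) (i : b.support) (v : P.weylGroup)
    (j : b.support) (a : ℂˣ) : thetaMono b d q i v (Y b j a) = thetaVar b d q i v j a := by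
  simp [thetaMono, Y]

theorem Theta_monomial (b : P.Base) (d : b.support → ℕ) (q : ℂˣ) (i : b.support)
    (v : P.weylGroup) (m : Mono b) :
    Theta b d q i (fun w => monomial b w m) v = thetaMono b d q i v m := by
  ext n
  change ∑ᶠ k : Mono b, (monomial b _ m).coeff k * _ = _
  rw [finsum_eq_single _ m]
  · simp [coeff_monomial]
  · intro k hk
    simp [coeff_monomial, hk]

end Sigma

end Completion

end

end QWeyl

namespace QWeyl

noncomputable section

open scoped Classical

set_option linter.unusedSectionVars false

variable {ι M N : Type*} [AddCommGroup M] [Module ℂ M] [AddCommGroup N] [Module ℂ N]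
  {P : RootPairing ι ℂ M N} [P.IsRootSystem] [P.IsCrystallographic] [Finite ι]

/-! ### The operators `Θ_i` are ring homomorphisms -/

/-! Monomials are written multiplicatively in these comments, although the code writes them
additively.

A composite of operators Θ along a word with product `g` maps the component at `v g` to the
component at `v` and never raises twisted weights (`IsTwisted`). A word with product `1` therefore
acts on each component separately, and the main task is to show that it acts there as the identity.

The tool is a rigidity principle, `IsTwisted.eq_of_generators`. An endomorphism of one component
that does not raise weights sends a monomial m to D(m) m, with D multiplicative. If, for m in a
generating set, it fixes some element with leading monomial m, then comparing terms height by height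
forces D = 1. Relations are thus proved without computing any composite: it is enough to exhibit
invariants.

For Θ_i² = 1 the invariants are Y_{j,a} with j ≠ i and Y_{i,a}(1 + A_{i,aq_i}^{-1}), the q-character
of a two-dimensional representation of quantum affine sl₂; its invariance comes from the difference
equation `sigma_eq`. For the relations between Θ_i and Θ_j the invariants are the fundamental
q-characters of types A₁×A₁, A₂, B₂ and G₂: finite sums of monomials that split into i-strings and,
in another way, into j-strings (`hasCharacter`). Their leading monomial is the highest one when `v`
is minimal in its coset of ⟨s_i, s_j⟩; any other `v` is reduced to this case by conjugation
(`rank_two_relations`).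

Involutions that satisfy the rank two relations extend to W by induction along descents
(`exists_monoidHom_of_rank_two`); uniqueness of minimal coset elements makes the result independent
of the descents chosen. The action is faithful because g ≠ 1 moves every component. -/

lemma finsum_finsum_comm {α β : Type*} (f : α → β → ℤ)
    (h : {p : α × β | f p.1 p.2 ≠ 0}.Finite) :
    ∑ᶠ a, ∑ᶠ c, f a c = ∑ᶠ c, ∑ᶠ a, f a c := by
  have h1 := finsum_curry (fun p : α × β => f p.1 p.2) h
  have h2 := finsum_curry (fun p : β × α => f p.2 p.1)
    ((h.image Prod.swap).subset fun p hp => ⟨p.swap, hp, p.swap_swap⟩)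
  rw [← h1, ← h2]
  exact (finsum_comp_equiv (Equiv.prodComm β α) (f := fun p : α × β => f p.1 p.2)).symm

/-- The weights of `y` lie below finitely many ν, so a product of weight above μ forces its first
factor above some μ - ν. This leaves finitely many first factors, and then finitely many second
ones. All interchanges of sums below rest on this. -/
lemma finite_pairs_above {b : P.Base} {w : P.weylGroup} (x y : Completion b w) (μ : M) :
    {p : Mono b × Mono b | x.coeff p.1 * y.coeff p.2 ≠ 0 ∧
      w • weight b p.1 + w • weight b p.2 - μ ∈ posCone b}.Finite := by
  obtain ⟨Λ, -, hΛ⟩ := y.admissible.cone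
  have hfin : (⋃ ν ∈ (Λ : Set M),
      ⋃ k ∈ {k | x.coeff k ≠ 0 ∧ w • weight b k - (μ - ν) ∈ posCone b},
      ({k} : Set (Mono b)) ×ˢ
        {l | y.coeff l ≠ 0 ∧ w • weight b l - (μ - w • weight b k) ∈ posCone b}).Finite :=
    Λ.finite_toSet.biUnion fun ν _ => (x.admissible.finite_above _).biUnion fun k _ =>
      (Set.finite_singleton k).prod (y.admissible.finite_above _)
  refine hfin.subset ?_
  rintro ⟨k, l⟩ ⟨hne, hc⟩
  have hx := left_ne_zero_of_mul hne
  have hy := right_ne_zero_of_mul hne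
  obtain ⟨ν, hν, hl⟩ := hΛ l hy
  simp only [Set.mem_iUnion]
  refine ⟨ν, hν, k, ⟨hx, ?_⟩, rfl, hy, ?_⟩
  · convert add_mem hc hl using 1
    simp only
    abel
  · convert hc using 1
    simp only
    abel

lemma finite_convolution {b : P.Base} {w : P.weylGroup} (x y : Completion b w) (n : Mono b) :
    {k | x.coeff k * y.coeff (n - k) ≠ 0}.Finite := by
  refine ((finite_pairs_above x y (w • weight b n)).image Prod.fst).subset ?_
  intro k hk
  refine ⟨(k, n - k), ⟨hk, ?_⟩, rfl⟩
  rw [map_sub, smul_sub, add_sub_cancel, sub_self]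
  exact zero_mem _

lemma thetaMono_zero (b : P.Base) (d : b.support → ℕ) (q : ℂˣ) (i : b.support)
    (v : P.weylGroup) : thetaMono b d q i v 0 = 1 := by
  simp [thetaMono]

lemma thetaMono_add (b : P.Base) (d : b.support → ℕ) (q : ℂˣ) (i : b.support)
    (v : P.weylGroup) (m n : Mono b) :
    thetaMono b d q i v (m + n) = thetaMono b d q i v m * thetaMono b d q i v n := by
  unfold thetaMono
  exact Finsupp.prod_add_index' (fun _ => zpow_zero _) (fun _ _ _ => zpow_add _ _ _)

lemma thetaComponent_add (b : P.Base) (d : b.support → ℕ) (q : ℂˣ) (i : b.support)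
    (v : P.weylGroup) (x y : Completion b (v * simpleRefl b i)) :
    thetaComponent b d q i v (x + y) =
      thetaComponent b d q i v x + thetaComponent b d q i v y := by
  ext n
  rw [coeff_add]
  change ∑ᶠ m, _ = ∑ᶠ m, _ + ∑ᶠ m, _
  rw [← finsum_add_distrib (theta_finite b d q i v x n) (theta_finite b d q i v y n)]
  exact finsum_congr fun m => by rw [coeff_add, add_mul]

/-- Multiplicativity on monomials passes to formal series because each coefficient involves only
finitely many terms. Both sides become one sum over pairs of monomials, the first of `x` and the
second of `y`. -/
lemma thetaComponent_mul (b : P.Base) (d : b.support → ℕ) (q : ℂˣ) (i : b.support)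
    (v : P.weylGroup) (x y : Completion b (v * simpleRefl b i)) :
    thetaComponent b d q i v (x * y) =
      thetaComponent b d q i v x * thetaComponent b d q i v y := by
  ext n
  rw [coeff_mul]
  set T : Mono b → Completion b v := fun m => thetaMono b d q i v m with hT
  have hTadd : ∀ m k, T (m + k) = T m * T k := fun m k => by
    simp only [hT, thetaMono_add, Units.val_mul]
  have hbound : ∀ {m k}, (T m).coeff k ≠ 0 →
      (v * simpleRefl b i) • weight b m - v • weight b k ∈ posCone b := fun h => thetaMono_bound h
  -- Since Θ_i does not raise twisted weights, only pairs whose product lies above `n` can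
  -- contribute to the coefficient at `n`.
  set S := {p : Mono b × Mono b | x.coeff p.1 * y.coeff p.2 ≠ 0 ∧
      (v * simpleRefl b i) • weight b p.1 + (v * simpleRefl b i) • weight b p.2
        - v • weight b n ∈ posCone b} with hS
  have hSfin : S.Finite := finite_pairs_above x y _
  have hmem : ∀ {k k' l}, x.coeff k * y.coeff k' ≠ 0 → (T k).coeff l ≠ 0 →
      (T k').coeff (n - l) ≠ 0 → (k, k') ∈ S := by
    intro k k' l h1 h2 h3
    refine ⟨h1, ?_⟩
    convert add_mem (hbound h2) (hbound h3) using 1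
    rw [map_sub, smul_sub]
    abel
  have hL : (thetaComponent b d q i v (x * y)).coeff n =
      ∑ᶠ p : Mono b × Mono b, x.coeff p.1 * y.coeff p.2 * (T p.1 * T p.2).coeff n := by
    change ∑ᶠ m, (x * y).coeff m * (T m).coeff n = _
    have hfin : {p : Mono b × Mono b |
        x.coeff p.2 * y.coeff (p.1 - p.2) * (T p.1).coeff n ≠ 0}.Finite := by
      refine (hSfin.image fun p => (p.1 + p.2, p.1)).subset ?_
      rintro ⟨m, k⟩ hp
      refine ⟨(k, m - k), ⟨left_ne_zero_of_mul hp, ?_⟩, by simp⟩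
      have := hbound (right_ne_zero_of_mul hp)
      rw [← smul_add, ← map_add]
      simpa using this
    rw [← finsum_comp_equiv (f := fun p : Mono b × Mono b =>
        x.coeff p.1 * y.coeff p.2 * (T p.1 * T p.2).coeff n)
      { toFun := fun p : Mono b × Mono b => (p.2, p.1 - p.2)
        invFun := fun p => (p.1 + p.2, p.1)
        left_inv := fun p => by simp
        right_inv := fun p => by simp }]
    rw [finsum_congr (g := fun p : Mono b × Mono b =>
        x.coeff p.2 * y.coeff (p.1 - p.2) * (T p.1).coeff n)
      (fun p => by rw [← hTadd]; simp), finsum_curry _ hfin]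
    refine finsum_congr fun m => ?_
    rw [coeff_mul, finsum_mul' _ _ (finite_convolution x y m)]
  have hR : ∀ l, (thetaComponent b d q i v x).coeff l *
      (thetaComponent b d q i v y).coeff (n - l) = ∑ᶠ p : Mono b × Mono b,
        x.coeff p.1 * y.coeff p.2 * ((T p.1).coeff l * (T p.2).coeff (n - l)) := by
    intro l
    change (∑ᶠ k, x.coeff k * (T k).coeff l) * (∑ᶠ k, y.coeff k * (T k).coeff (n - l)) = _
    rw [finsum_mul' _ _ (theta_finite b d q i v x l), finsum_curry]
    · refine finsum_congr fun k => ?_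
      rw [mul_finsum' _ _ (theta_finite b d q i v y (n - l))]
      exact finsum_congr fun k' => by ring
    · refine hSfin.subset ?_
      rintro ⟨k, k'⟩ hp
      have h2 := right_ne_zero_of_mul hp
      exact hmem (left_ne_zero_of_mul hp) (left_ne_zero_of_mul h2) (right_ne_zero_of_mul h2)
  rw [hL, finsum_congr hR, finsum_finsum_comm]
  · refine finsum_congr fun p => ?_
    rw [coeff_mul, mul_finsum' _ _ (finite_convolution _ _ n)]
  · refine (hSfin.biUnion fun p _ => ((finite_convolution (T p.1) (T p.2) n).prod
      (Set.finite_singleton p))).subset ?_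
    rintro ⟨l, p⟩ hp
    have h2 := right_ne_zero_of_mul hp
    simp only [Set.mem_iUnion]
    exact ⟨p, hmem (left_ne_zero_of_mul hp) (left_ne_zero_of_mul h2) (right_ne_zero_of_mul h2),
      h2, rfl⟩

/-- The element of `Π` all of whose components are the monomial `m`. -/
def mono (b : P.Base) (m : Mono b) : BigPi b := fun w => monomial b w m

lemma mono_add (b : P.Base) (m n : Mono b) : mono b (m + n) = mono b m * mono b n :=
  funext fun _ => (monomial_mul m n).symm

lemma mono_zero (b : P.Base) : mono b 0 = 1 := funext fun _ => monomial_zero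

/-- `Θ_i` as a ring homomorphism. -/
def thetaHom (b : P.Base) (d : b.support → ℕ) (q : ℂˣ) (i : b.support) : BigPi b →+* BigPi b :=
  RingHom.mk'
    { toFun := Theta b d q i
      map_one' := by
        rw [← mono_zero]
        funext v
        refine (Theta_monomial b d q i v 0).trans ?_
        rw [thetaMono_zero]
        exact monomial_zero.symm
      map_mul' := fun x y => funext fun v => thetaComponent_mul b d q i v _ _ }
    fun x y => funext fun v => thetaComponent_add b d q i v _ _

lemma thetaHom_mono (b : P.Base) (d : b.support → ℕ) (q : ℂˣ) (i : b.support) (m : Mono b)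
    (v : P.weylGroup) : thetaHom b d q i (mono b m) v = thetaMono b d q i v m :=
  Theta_monomial b d q i v m

/-! ### Continuity -/

/-- A ring endomorphism of `Π` that maps the component at `v g` continuously to the component
at `v` and does not raise twisted weights. -/
def IsTwisted (b : P.Base) (g : P.weylGroup) (F : BigPi b →+* BigPi b) : Prop :=
  ∀ (v : P.weylGroup) (n : Mono b) (x : BigPi b),
    (∀ m, (x (v * g)).coeff m ≠ 0 → (v * g) • weight b m - v • weight b n ∉ posCone b) →
      (F x v).coeff n = 0

lemma coeff_zero {b : P.Base} {w : P.weylGroup} (n : Mono b) :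
    (0 : Completion b w).coeff n = 0 := by
  have := coeff_add (0 : Completion b w) 0 n
  rw [add_zero] at this
  omega

lemma IsTwisted.one (b : P.Base) : IsTwisted b 1 (RingHom.id (BigPi b)) := by
  intro v n x h
  by_contra hne
  rw [mul_one] at h
  exact h n hne (by rw [sub_self]; exact zero_mem _)

/-- Indices are translated on the right: at `v` the map `F` reads the component of `G x` at `v g`,
which reads `x` at `v g h`. Hence words in the Θ's and words in the s's multiply in the same order.
-/
lemma IsTwisted.comp {b : P.Base} {g h : P.weylGroup} {F G : BigPi b →+* BigPi b}
    (hF : IsTwisted b g F) (hG : IsTwisted b h G) : IsTwisted b (g * h) (F.comp G) := by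
  intro v n x hx
  refine hF v n (G x) fun m hm hc => hm (hG (v * g) m x fun k hk hc' => ?_)
  rw [mul_assoc] at hk hc'
  refine hx k hk ?_
  have := add_mem hc hc'
  convert this using 1
  abel

lemma isTwisted_thetaHom (b : P.Base) (d : b.support → ℕ) (q : ℂˣ) (i : b.support) :
    IsTwisted b (simpleRefl b i) (thetaHom b d q i) := by
  intro v n x hx
  by_contra hne
  obtain ⟨m, hm⟩ := exists_ne_of_finsum_ne hne
  exact hx m (left_ne_zero_of_mul hm) (thetaMono_bound (right_ne_zero_of_mul hm))

/-- The component at `v` of `F x` depends only on the component of `x` at `v g`. -/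
lemma IsTwisted.congr {b : P.Base} {g : P.weylGroup} {F : BigPi b →+* BigPi b}
    (hF : IsTwisted b g F) {v : P.weylGroup} {x y : BigPi b} (h : x (v * g) = y (v * g)) :
    F x v = F y v := by
  rw [← sub_eq_zero, ← Pi.sub_apply, ← map_sub]
  ext n
  rw [coeff_zero]
  refine hF v n _ fun m hm => absurd ?_ hm
  rw [Pi.sub_apply, h, sub_self, coeff_zero]

/-- A continuous endomorphism is the identity at `v` if it fixes the monomials at `v`. -/
lemma IsTwisted.eq_of_mono {b : P.Base} {F : BigPi b →+* BigPi b} (hF : IsTwisted b 1 F)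
    {v : P.weylGroup} (h : ∀ m, F (mono b m) v = monomial b v m) (x : BigPi b) :
    F x v = x v := by
  ext n
  have hfin := (x v).admissible.finite_above (v • weight b n)
  set s := hfin.toFinset with hs
  -- The truncation of `x` at `v` to the finitely many monomials above `n`. `F` fixes it by
  -- additivity, and the remainder has no term high enough to reach `n`.
  set y : BigPi b := ∑ m ∈ s, ((x v).coeff m) • mono b m with hy
  have hc : ∀ k, (y v).coeff k = if k ∈ s then (x v).coeff k else 0 := by
    intro k
    let ev : BigPi b →+ ℤ :=
      { toFun := fun z => (z v).coeff k
        map_zero' := coeff_zero k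
        map_add' := fun z z' => coeff_add _ _ k }
    have h1 : ∀ m, ev (mono b m) = if k = m then 1 else 0 := fun m => coeff_monomial m k
    change ev y = _
    rw [hy, map_sum]
    simp only [map_zsmul, h1, smul_eq_mul, mul_ite, mul_one, mul_zero]
    exact Finset.sum_ite_eq s k _
  have hFy : F y v = y v := by
    rw [hy, map_sum, Finset.sum_apply, Finset.sum_apply]
    refine Finset.sum_congr rfl fun m _ => ?_
    rw [map_zsmul, Pi.smul_apply, h, Pi.smul_apply]
    rfl
  have h0 : (F (x - y) v).coeff n = 0 := by
    refine hF v n _ fun m hm hcone => hm ?_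
    rw [mul_one] at hcone ⊢
    have h2 : (x - y) v + y v = x v := by rw [Pi.sub_apply, sub_add_cancel]
    have h3 := coeff_add ((x - y) v) (y v) m
    rw [h2, hc] at h3
    by_cases hm' : m ∈ s
    · rw [if_pos hm'] at h3
      omega
    · have : (x v).coeff m = 0 := by
        by_contra hne
        exact hm' (hfin.mem_toFinset.2 ⟨hne, hcone⟩)
      rw [if_neg hm', this] at h3
      omega
  have h4 : F (x - y) v + y v = F x v := by
    rw [map_sub, Pi.sub_apply, hFy, sub_add_cancel]
  rw [← h4, coeff_add, h0, hc, zero_add, ite_eq_left_iff]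
  intro hn
  by_contra hne
  exact hn (hfin.mem_toFinset.2 ⟨fun e => hne e.symm, by rw [sub_self]; exact zero_mem _⟩)

/-! ### The difference equation for `Σ_{i,a}` -/

lemma coeff_monomial_mul {b : P.Base} {w : P.weylGroup} (m n : Mono b) (x : Completion b w) :
    (monomial b w m * x).coeff n = x.coeff (n - m) := by
  rw [coeff_mul, finsum_eq_single _ m]
  · simp [coeff_monomial]
  · intro k hk
    simp [coeff_monomial, hk]

lemma coeff_one {b : P.Base} {w : P.weylGroup} (n : Mono b) :
    (1 : Completion b w).coeff n = if n = 0 then 1 else 0 := by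
  rw [← monomial_zero, coeff_monomial]

/-- By definition the product grows at its last factor. The difference equation needs the first
factor split off instead, at the cost of shifting the parameter by q_i^{-2}; `U_succ` does the same
for the other series. -/
lemma V_succ (b : P.Base) (d : b.support → ℕ) (q : ℂˣ) (i : b.support) (a : ℂˣ) (k : ℕ) :
    V b d q i a (k + 1) = -A b d q i a + V b d q i (a * (q ^ d i) ^ (-2 : ℤ)) k := by
  have h : ∀ (a : ℂˣ) k, V b d q i a (k + 1) = V b d q i a k +
      -A b d q i (a * (q ^ d i) ^ (-2 * (k : ℤ))) := fun a k => by
    rw [V, Finset.sum_Icc_succ_top (by omega), ← V]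
    congr 5
    push_cast
    ring
  induction k with
  | zero => rw [h]; simp [V]
  | succ k ih =>
    rw [h, ih, h, add_assoc, mul_assoc, ← zpow_add]
    congr 6
    push_cast
    ring

lemma U_succ (b : P.Base) (d : b.support → ℕ) (q : ℂˣ) (i : b.support) (a : ℂˣ) (k : ℕ) :
    U b d q i (a * (q ^ d i) ^ (-2 : ℤ)) (k + 1) = A b d q i a + U b d q i a k := by
  have h : ∀ (a : ℂˣ) k, U b d q i a (k + 1) = U b d q i a k +
      A b d q i (a * (q ^ d i) ^ (2 * ((k : ℤ) + 1))) := fun a k => by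
    rw [U, Finset.sum_Icc_succ_top (by omega), ← U]
    push_cast
    rfl
  induction k with
  | zero =>
    rw [h, mul_assoc, ← zpow_add]
    simp [U]
  | succ k ih =>
    rw [h, ih, h, add_assoc, mul_assoc, ← zpow_add]
    congr 6
    push_cast
    ring

/-- The terms have the pairwise distinct weights -kα_i, so no monomial occurs twice. -/
lemma sigmaPlus_eq (b : P.Base) (d : b.support → ℕ) (q : ℂˣ) (i : b.support) (a : ℂˣ)
    (m : Mono b) : sigmaPlus b d q i a m = if ∃ k, m = V b d q i a k then 1 else 0 := by
  split_ifs with h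
  · obtain ⟨k, rfl⟩ := h
    rw [sigmaPlus, finsum_eq_single _ k, if_pos rfl]
    intro l hl
    rw [if_neg]
    intro e
    have := congrArg (weight b) e
    rw [weight_V, weight_V] at this
    exact hl (nsmul_root_injective P (i : ι) (neg_injective this)).symm
  · by_contra hne
    exact h (exists_of_sigmaPlus_ne hne)

lemma sigmaMinus_eq (b : P.Base) (d : b.support → ℕ) (q : ℂˣ) (i : b.support) (a : ℂˣ)
    (m : Mono b) :
    sigmaMinus b d q i a m = -if ∃ k, m = U b d q i a (k + 1) then 1 else 0 := by
  split_ifs with h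
  · obtain ⟨k, rfl⟩ := h
    rw [sigmaMinus, finsum_eq_single _ (k + 1), if_pos ⟨k.succ_pos, rfl⟩]
    intro l hl
    rw [if_neg]
    rintro ⟨-, e⟩
    have := congrArg (weight b) e
    rw [weight_U, weight_U] at this
    exact hl (nsmul_root_injective P (i : ι) this).symm
  · by_contra hne
    rw [neg_zero] at hne
    obtain ⟨k, hk, e⟩ := exists_of_sigmaMinus_ne hne
    exact h ⟨k - 1, by rw [e, Nat.sub_add_cancel hk]⟩

/-- The difference equation `Σ_{i,a} = 1 + A_{i,a}^{-1} Σ_{i,a q_i^{-2}}`. -/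
theorem sigma_eq (b : P.Base) (d : b.support → ℕ) (q : ℂˣ) (w : P.weylGroup) (i : b.support)
    (a : ℂˣ) : sigma b d q w i a =
      1 + monomial b w (-A b d q i a) * sigma b d q w i (a * (q ^ d i) ^ (-2 : ℤ)) := by
  ext n
  rw [coeff_add, coeff_monomial_mul, coeff_one, sub_neg_eq_add]
  change sigmaCoeff _ _ _ _ _ _ _ = _ + sigmaCoeff _ _ _ _ _ _ _
  unfold sigmaCoeff
  split_ifs with hw h0 h0
  · subst h0
    rw [sigmaPlus_eq, sigmaPlus_eq, if_pos ⟨0, by simp [V]⟩, if_neg, add_zero]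
    rintro ⟨k, hk⟩
    have := congrArg (weight b) hk
    rw [weight_V, zero_add, weight_A, eq_neg_iff_add_eq_zero, ← succ_nsmul'] at this
    exact absurd (nsmul_root_injective P (i : ι) (this.trans (zero_smul ℕ _).symm)) (by simp)
  · rw [sigmaPlus_eq, sigmaPlus_eq, zero_add]
    refine if_congr ⟨?_, ?_⟩ rfl rfl
    · rintro ⟨k, rfl⟩
      cases k with
      | zero => exact absurd (by simp [V]) h0
      | succ k => exact ⟨k, by rw [V_succ]; abel⟩
    · rintro ⟨k, hk⟩
      exact ⟨k + 1, by rw [V_succ, ← hk]; abel⟩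
  -- The negative series has no constant term: the leading term -A_{i,a} of the shifted series,
  -- multiplied by A_{i,a}^{-1}, cancels the summand 1.
  · subst h0
    rw [sigmaMinus_eq, sigmaMinus_eq, if_neg, if_pos ⟨0, by rw [U_succ]; simp [U]⟩]
    · rfl
    · rintro ⟨k, hk⟩
      have := congrArg (weight b) hk
      rw [weight_U, map_zero] at this
      exact absurd (nsmul_root_injective P (i : ι) (this.symm.trans (zero_smul ℕ _).symm)) (by simp)
  · rw [sigmaMinus_eq, sigmaMinus_eq, zero_add]
    congr 1
    refine if_congr ⟨?_, ?_⟩ rfl rfl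
    · rintro ⟨k, rfl⟩
      exact ⟨k + 1, by rw [U_succ]; abel⟩
    · rintro ⟨k, hk⟩
      rw [U_succ, add_comm] at hk
      cases k with
      | zero => exact absurd (by simpa [U] using hk) h0
      | succ k => exact ⟨k, add_left_cancel hk⟩

/-! ### Invariants of `Θ_i` -/

/-- The part of a monomial that involves the variables `Y_{i,a}`. -/
def part (b : P.Base) (i : b.support) : Mono b →+ (ℂˣ →₀ ℤ) :=
  Finsupp.comapDomain.addMonoidHom (f := fun a : ℂˣ => (i, a)) fun _ _ h => (Prod.ext_iff.1 h).2

lemma part_apply (b : P.Base) (i : b.support) (m : Mono b) (a : ℂˣ) :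
    part b i m a = m (i, a) := rfl

lemma part_Y_same (b : P.Base) (i : b.support) (a : ℂˣ) :
    part b i (Y b i a) = Finsupp.single a 1 := by
  ext c
  rw [part_apply, Y, Finsupp.single_apply, Finsupp.single_apply]
  simp

lemma part_Y_ne (b : P.Base) {i j : b.support} (h : j ≠ i) (a : ℂˣ) :
    part b i (Y b j a) = 0 := by
  ext c
  rw [part_apply, Y, Finsupp.single_apply]
  simp [h]

/-- Monomials as invertible elements, as a homomorphism. -/
def monoUnitHom (b : P.Base) (w : P.weylGroup) : Mono b →+ Additive (Completion b w)ˣ where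
  toFun m := Additive.ofMul (monoUnit b w m)
  map_zero' := congrArg Additive.ofMul (Units.ext monomial_zero)
  map_add' m n := congrArg Additive.ofMul (Units.ext (monomial_mul m n).symm)

lemma monoUnit_add (b : P.Base) (w : P.weylGroup) (m n : Mono b) :
    monoUnit b w (m + n) = monoUnit b w m * monoUnit b w n :=
  (monoUnitHom b w).map_add m n

/-- `Θ_i` on monomials, as a homomorphism. -/
def thetaMonoHom (b : P.Base) (d : b.support → ℕ) (q : ℂˣ) (i : b.support) (v : P.weylGroup) :
    Mono b →+ Additive (Completion b v)ˣ where
  toFun m := Additive.ofMul (thetaMono b d q i v m)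
  map_zero' := congrArg Additive.ofMul (thetaMono_zero b d q i v)
  map_add' m n := congrArg Additive.ofMul (thetaMono_add b d q i v m n)

lemma thetaMono_neg (b : P.Base) (d : b.support → ℕ) (q : ℂˣ) (i : b.support) (v : P.weylGroup)
    (m : Mono b) : thetaMono b d q i v (-m) = (thetaMono b d q i v m)⁻¹ :=
  (thetaMonoHom b d q i v).map_neg m

lemma thetaMono_of_part_eq_zero {b : P.Base} (d : b.support → ℕ) (q : ℂˣ) {i : b.support}
    (v : P.weylGroup) {m : Mono b} (h : part b i m = 0) :
    thetaMono b d q i v m = monoUnit b v m := by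
  have h1 : ∀ m : Mono b, monoUnit b v m =
      m.prod fun p u => monoUnit b v (Y b p.1 p.2) ^ u := by
    intro m
    induction m using Finsupp.induction_linear with
    | zero => exact (monoUnitHom b v).map_zero
    | add f g hf hg =>
      rw [monoUnit_add, hf, hg, Finsupp.prod_add_index' (fun _ => zpow_zero _)
        (fun _ _ _ => zpow_add _ _ _)]
    | single p u =>
      rw [Finsupp.prod_single_index (zpow_zero _)]
      have h2 : (Finsupp.single p u : Mono b) = u • Y b p.1 p.2 := by simp [Y]
      rw [h2]
      exact (monoUnitHom b v).map_zsmul u _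
  rw [h1, thetaMono]
  refine Finsupp.prod_congr fun p hp => ?_
  rw [thetaVar, if_neg]
  rintro rfl
  exact (Finsupp.mem_support_iff.1 hp) (DFunLike.congr_fun h p.2)

/-- The algebra behind the invariance of Y_{i,a}(1 + A_{i,aq_i}^{-1}). Here s₀, s₁, s₂ stand for Σ
at a q_i^{-3}, a q_i^{-1}, a q_i, and a₀, a₁ for A at a q_i^{-1}, a q_i. The two difference
equations combine to s₂ + a₀⁻¹ s₀ = s₁ (1 + a₁⁻¹). -/
lemma theta_string_aux {R : Type*} [CommRing R] (y a₀ a₁ s₀ s₁ s₂ : Rˣ)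
    (h₁ : (s₁ : R) = 1 + (a₀⁻¹ : Rˣ) * s₀) (h₂ : (s₂ : R) = 1 + (a₁⁻¹ : Rˣ) * s₁) :
    ((y * a₀⁻¹ * (s₀ / s₁) : Rˣ) : R) * (1 + ((a₀ * s₂ / s₀ : Rˣ) : R)) =
      (y : R) * (1 + (a₁⁻¹ : Rˣ)) := by
  have e0 : ((a₀⁻¹ : Rˣ) : R) * a₀ = 1 := a₀.inv_mul
  have e1 : ((s₁⁻¹ : Rˣ) : R) * s₁ = 1 := s₁.inv_mul
  have e2 : (s₀ : R) * ((s₀⁻¹ : Rˣ) : R) = 1 := s₀.mul_inv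
  simp only [div_eq_mul_inv, Units.val_mul]
  have : (s₂ : R) + (a₀⁻¹ : Rˣ) * s₀ = s₁ * (1 + (a₁⁻¹ : Rˣ)) := by rw [h₂, h₁]; ring
  calc _ = (y : R) * (s₁⁻¹ : Rˣ) * (((a₀⁻¹ : Rˣ) * a₀) * (s₀ * (s₀⁻¹ : Rˣ)) * s₂ +
        (a₀⁻¹ : Rˣ) * s₀) := by ring
    _ = _ := by rw [e0, e2, one_mul, one_mul, this]; linear_combination (y : R) * (1 + (a₁⁻¹ : Rˣ)) * e1

/-- The invariants of `Θ_i`. -/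
def invariants (b : P.Base) (d : b.support → ℕ) (q : ℂˣ) (i : b.support) : Subring (BigPi b) :=
  (thetaHom b d q i).eqLocus (RingHom.id _)

lemma mem_invariants {b : P.Base} {d : b.support → ℕ} {q : ℂˣ} {i : b.support} {x : BigPi b} :
    x ∈ invariants b d q i ↔ thetaHom b d q i x = x := Iff.rfl

lemma mono_mem_invariants {b : P.Base} (d : b.support → ℕ) (q : ℂˣ) {i : b.support} {m : Mono b}
    (h : part b i m = 0) : mono b m ∈ invariants b d q i := by
  rw [mem_invariants]
  funext v
  rw [thetaHom_mono, thetaMono_of_part_eq_zero d q v h]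
  rfl

lemma part_A_self (b : P.Base) (d : b.support → ℕ) (q : ℂˣ) (i : b.support) (a : ℂˣ) :
    part b i (A b d q i a) =
      Finsupp.single (a * (q ^ d i)⁻¹) 1 + Finsupp.single (a * q ^ d i) 1 := by
  have hii : cartan b i i = 2 := b.cartanMatrix_apply_same i
  have h : ∀ (c : ℤ), c ≠ 2 → ∀ j ∈ Finset.univ.filter (fun j => cartan b j i = c), j ≠ i := by
    rintro c hc j hj rfl
    exact hc ((Finset.mem_filter.1 hj).2.symm.trans hii)
  simp only [A, map_sub, map_add, map_sum, part_Y_same]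
  rw [Finset.sum_eq_zero fun j hj => part_Y_ne b (h (-1) (by norm_num) j hj) _,
    Finset.sum_eq_zero fun j hj => by
      rw [part_Y_ne b (h (-2) (by norm_num) j hj), part_Y_ne b (h (-2) (by norm_num) j hj),
        add_zero],
    Finset.sum_eq_zero fun j hj => by
      rw [part_Y_ne b (h (-3) (by norm_num) j hj), part_Y_ne b (h (-3) (by norm_num) j hj),
        part_Y_ne b (h (-3) (by norm_num) j hj), add_zero, add_zero]]
  simp

lemma thetaMono_Y_same (b : P.Base) (d : b.support → ℕ) (q : ℂˣ) (i : b.support)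
    (v : P.weylGroup) (a : ℂˣ) : thetaMono b d q i v (Y b i a) =
      monoUnit b v (Y b i a) * (monoUnit b v (A b d q i (a * (q ^ d i)⁻¹)))⁻¹ *
      (sigmaUnit b d q v i (a * ((q ^ d i) ^ 3)⁻¹) / sigmaUnit b d q v i (a * (q ^ d i)⁻¹)) := by
  rw [thetaMono_Y, thetaVar, if_pos rfl]

/-- The image of `A_{i,a}` under `Θ_i`. -/
lemma thetaMono_A (b : P.Base) (d : b.support → ℕ) (q : ℂˣ) (i : b.support) (v : P.weylGroup)
    (a : ℂˣ) : thetaMono b d q i v (A b d q i (a * q ^ d i)) =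
      (monoUnit b v (A b d q i (a * (q ^ d i)⁻¹)))⁻¹ *
        (sigmaUnit b d q v i (a * ((q ^ d i) ^ 3)⁻¹) / sigmaUnit b d q v i (a * q ^ d i)) := by
  -- The factor `r` contains no Y_{i,c}, so Θ_i fixes it. In the images of the two remaining
  -- variables the factors Σ at a q_i^{-1} cancel.
  obtain ⟨r, hr⟩ : ∃ r, A b d q i (a * q ^ d i) = Y b i a + Y b i (a * (q ^ d i) ^ 2) + r :=
    ⟨_, (add_sub_cancel _ _).symm⟩
  have h0 : part b i r = 0 := by
    have := congrArg (part b i) hr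
    rw [part_A_self, map_add, map_add, part_Y_same, part_Y_same, mul_inv_cancel_right, mul_assoc,
      ← sq] at this
    simpa using this
  have h1 : monoUnit b v r = monoUnit b v (A b d q i (a * q ^ d i)) /
      (monoUnit b v (Y b i a) * monoUnit b v (Y b i (a * (q ^ d i) ^ 2))) := by
    rw [eq_div_iff_mul_eq', hr, monoUnit_add, monoUnit_add, mul_comm]
  rw [hr, thetaMono_add, thetaMono_add, thetaMono_of_part_eq_zero d q v h0, h1, thetaMono_Y_same,
    thetaMono_Y_same]
  have e1 : a * (q ^ d i) ^ 2 * (q ^ d i)⁻¹ = a * q ^ d i := by rw [sq]; group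
  have e2 : a * (q ^ d i) ^ 2 * ((q ^ d i) ^ 3)⁻¹ = a * (q ^ d i)⁻¹ := by group
  rw [e1, e2, ← div_eq_one]
  simp only [div_eq_mul_inv, mul_inv, inv_inv]
  generalize monoUnit b v (Y b i a) = x1
  generalize monoUnit b v (Y b i (a * (q ^ d i) ^ 2)) = x2
  generalize monoUnit b v (A b d q i (a * q ^ d i)) = x3
  generalize monoUnit b v (A b d q i (a * (q ^ d i)⁻¹)) = x4
  generalize sigmaUnit b d q v i _ = x5
  generalize sigmaUnit b d q v i _ = x6
  generalize sigmaUnit b d q v i _ = x7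
  apply Additive.ofMul.injective
  simp only [ofMul_mul, ofMul_inv, ofMul_one]
  abel

/-- If the variables `Y_{i,c}` enter the monomial `m` only by `Y_{i,a}`, then
`m (1 + A_{i,a q_i}^{-1})` is invariant under `Θ_i`. -/
theorem string_one_mem_invariants {b : P.Base} (d : b.support → ℕ) (q : ℂˣ) {i : b.support}
    {m : Mono b} {a : ℂˣ} (h : part b i m = Finsupp.single a 1) :
    mono b m * (1 + mono b (-A b d q i (a * q ^ d i))) ∈ invariants b d q i := by
  have hY : mono b (Y b i a) * (1 + mono b (-A b d q i (a * q ^ d i))) ∈ invariants b d q i := by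
    rw [mem_invariants, map_mul, map_add, map_one]
    funext v
    rw [Pi.mul_apply, Pi.add_apply, thetaHom_mono, thetaHom_mono, thetaMono_neg, thetaMono_Y_same,
      thetaMono_A]
    have := theta_string_aux (monoUnit b v (Y b i a)) (monoUnit b v (A b d q i (a * (q ^ d i)⁻¹)))
      (monoUnit b v (A b d q i (a * q ^ d i))) (sigmaUnit b d q v i (a * ((q ^ d i) ^ 3)⁻¹))
      (sigmaUnit b d q v i (a * (q ^ d i)⁻¹)) (sigmaUnit b d q v i (a * q ^ d i))
      (by
        have := sigma_eq b d q v i (a * (q ^ d i)⁻¹)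
        rw [show a * (q ^ d i)⁻¹ * (q ^ d i) ^ (-2 : ℤ) = a * ((q ^ d i) ^ 3)⁻¹ by group] at this
        exact this)
      (by
        have := sigma_eq b d q v i (a * q ^ d i)
        rw [show a * q ^ d i * (q ^ d i) ^ (-2 : ℤ) = a * (q ^ d i)⁻¹ by
          rw [mul_assoc]; congr 1; group] at this
        exact this)
    refine Eq.trans ?_ this
    congr 3
    simp only [div_eq_mul_inv, mul_inv, inv_inv]
    rw [mul_assoc, mul_comm (sigmaUnit _ _ _ _ _ _)⁻¹]
  have h2 : mono b (m - Y b i a) ∈ invariants b d q i := by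
    refine mono_mem_invariants d q ?_
    rw [map_sub, h, part_Y_same, sub_self]
  have := mul_mem h2 hY
  rwa [← mul_assoc, ← mono_add, sub_add_cancel] at this

/-! ### Rigidity of continuous endomorphisms -/

lemma coeff_neg {b : P.Base} {w : P.weylGroup} (x : Completion b w) (n : Mono b) :
    (-x).coeff n = -x.coeff n := by
  have := coeff_add (-x) x n
  rw [neg_add_cancel, coeff_zero] at this
  omega

/-- The series all of whose monomials have `v`-twisted weight in `-Q⁺` and of height at
most `-h`. -/
def heightFiltration (b : P.Base) (v : P.weylGroup) (h : ℕ) : AddSubgroup (Completion b v) where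
  carrier := {x | ∀ n, x.coeff n ≠ 0 → ∃ c, -(v • weight b n) = coneSum b c ∧ h ≤ ∑ i, c i}
  zero_mem' := fun n hn => absurd (coeff_zero n) hn
  add_mem' := by
    intro x y hx hy n hn
    rw [coeff_add] at hn
    by_cases h0 : x.coeff n = 0
    · exact hy n (by simpa [h0] using hn)
    · exact hx n h0
  neg_mem' := by
    intro x hx n hn
    rw [coeff_neg] at hn
    exact hx n (neg_ne_zero.1 hn)

lemma mul_mem_heightFiltration {b : P.Base} {v : P.weylGroup} {h k : ℕ} {x y : Completion b v}
    (hx : x ∈ heightFiltration b v h) (hy : y ∈ heightFiltration b v k) :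
    x * y ∈ heightFiltration b v (h + k) := by
  intro n hn
  obtain ⟨m, hm, hm'⟩ := exists_of_coeff_mul_ne_zero hn
  obtain ⟨c, hc, hc'⟩ := hx m hm
  obtain ⟨e, he, he'⟩ := hy _ hm'
  refine ⟨c + e, ?_, ?_⟩
  · rw [coneSum_add, ← hc, ← he, map_sub, smul_sub]
    abel
  · simp only [Pi.add_apply, Finset.sum_add_distrib]
    omega

/-- The weight of a monomial determines its height, as coordinates in the simple roots are unique;
so no monomial survives in every step of the filtration. -/
lemma eq_zero_of_mem_heightFiltration {b : P.Base} {v : P.weylGroup} {x : Completion b v}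
    (hx : ∀ h, x ∈ heightFiltration b v h) : x = 0 := by
  ext n
  rw [coeff_zero]
  by_contra hn
  obtain ⟨c, hc, -⟩ := hx 0 n hn
  obtain ⟨e, he, he'⟩ := hx (∑ i, c i + 1) n hn
  rw [coneSum_injective b (hc.symm.trans he)] at he'
  omega

lemma one_mem_heightFiltration (b : P.Base) (v : P.weylGroup) :
    (1 : Completion b v) ∈ heightFiltration b v 0 := by
  intro n hn
  rw [coeff_one] at hn
  have : n = 0 := by by_contra h; simp [h] at hn
  subst this
  exact ⟨0, by simp [coneSum], by simp⟩

lemma monomial_mem_heightFiltration {b : P.Base} {v : P.weylGroup} {m : Mono b} {h : ℕ}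
    {c : b.support → ℕ} (hc : -(v • weight b m) = coneSum b c) (hh : h ≤ ∑ i, c i) :
    monomial b v m ∈ heightFiltration b v h := by
  intro n hn
  rw [coeff_monomial] at hn
  have : n = m := by by_contra h; simp [h] at hn
  subst this
  exact ⟨c, hc, hh⟩

lemma monomial_mem_heightFiltration_one {b : P.Base} {v : P.weylGroup} {m : Mono b}
    (h : -(v • weight b m) ∈ posCone b) (h0 : weight b m ≠ 0) :
    monomial b v m ∈ heightFiltration b v 1 := by
  obtain ⟨c, hc⟩ := (mem_posCone_iff b _).1 h
  refine monomial_mem_heightFiltration hc (Nat.one_le_iff_ne_zero.2 fun h1 => h0 ?_)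
  have : c = 0 := funext fun i => (Finset.sum_eq_zero_iff.1 h1) i (Finset.mem_univ i)
  rw [this, coneSum, neg_eq_iff_eq_neg] at hc
  have h2 : v • weight b m = 0 := by simpa using hc
  exact (smul_eq_zero_iff_eq v).1 h2

lemma monomial_neg_A_mem {b : P.Base} (d : b.support → ℕ) (q : ℂˣ) {v : P.weylGroup}
    {i : b.support} (h : v • P.root i ∈ posCone b) (a : ℂˣ) :
    monomial b v (-A b d q i a) ∈ heightFiltration b v 1 :=
  monomial_mem_heightFiltration_one (by rwa [map_neg, weight_A, smul_neg, neg_neg])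
    (by rw [map_neg, weight_A, neg_ne_zero]; exact P.ne_zero _)

lemma monomial_A_mem {b : P.Base} (d : b.support → ℕ) (q : ℂˣ) {v : P.weylGroup}
    {i : b.support} (h : -(v • P.root i) ∈ posCone b) (a : ℂˣ) :
    monomial b v (A b d q i a) ∈ heightFiltration b v 1 :=
  monomial_mem_heightFiltration_one (by rwa [weight_A]) (by rw [weight_A]; exact P.ne_zero _)

/-- A continuous ring endomorphism that fixes, for generators `m` of the group of monomials,
an element with leading monomial `m`, is the identity. -/
theorem IsTwisted.eq_of_generators {b : P.Base} {F : BigPi b →+* BigPi b} (hF : IsTwisted b 1 F)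
    {v : P.weylGroup} (S : Set (Mono b)) (hS : AddSubgroup.closure S = ⊤)
    (h : ∀ m ∈ S, ∃ R : List (Mono b), (∀ r ∈ R, monomial b v r ∈ heightFiltration b v 1) ∧
      F (mono b m * (1 + (R.map (mono b)).sum)) = mono b m * (1 + (R.map (mono b)).sum))
    (x : BigPi b) : F x v = x v := by
  refine hF.eq_of_mono (fun m => ?_) x
  -- The ratio F(m)/m is multiplicative in `m`, and it lies in filtration degree 0 because `F` does
  -- not raise weights.
  set D : Mono b → Completion b v := fun m => F (mono b m) v * monomial b v (-m) with hD
  have hcancel : ∀ m : Mono b, monomial b v (-m) * monomial b v m = 1 := fun m => by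
    rw [monomial_mul, neg_add_cancel, monomial_zero]
  have hFD : ∀ m, F (mono b m) v = D m * monomial b v m := fun m => by
    rw [hD, mul_assoc, hcancel, mul_one]
  have hDadd : ∀ m n, D (m + n) = D m * D n := fun m n => by
    simp only [hD]
    rw [mono_add, map_mul, Pi.mul_apply, neg_add, ← monomial_mul]
    ring
  have hD0 : D 0 = 1 := by
    simp only [hD]
    rw [mono_zero, map_one, neg_zero, monomial_zero]
    exact mul_one _
  have hDmem : ∀ m, D m ∈ heightFiltration b v 0 := by
    intro m n hn
    simp only [hD] at hn
    rw [mul_comm, coeff_monomial_mul, sub_neg_eq_add] at hn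
    have h1 : v • weight b m - v • weight b (n + m) ∈ posCone b := by
      by_contra hc
      refine hn (hF v (n + m) _ fun k hk => ?_)
      rw [mul_one] at hk ⊢
      have : k = m := by
        by_contra hne
        exact hk ((coeff_monomial m k).trans (if_neg hne))
      rwa [this]
    rw [map_add, smul_add, sub_add_cancel_right] at h1
    obtain ⟨c, hc⟩ := (mem_posCone_iff b _).1 h1
    exact ⟨c, hc, Nat.zero_le _⟩
  clear_value D
  -- The statement concerns all monomials at once: passing from height k to k + 1 for a generator
  -- `m` uses height k for the products `m + r`, which need not be generators.
  suffices key : ∀ h m, D m - 1 ∈ heightFiltration b v h by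
    rw [hFD, sub_eq_zero.1 (eq_zero_of_mem_heightFiltration fun h => key h m), one_mul]
  intro k
  induction k with
  | zero => exact fun m => sub_mem (hDmem m) (one_mem_heightFiltration b v)
  | succ k ih =>
    intro m
    have hm : m ∈ AddSubgroup.closure S := by rw [hS]; trivial
    induction hm using AddSubgroup.closure_induction with
    | mem m hm =>
      obtain ⟨R, hR, hfix⟩ := h m hm
      -- The equation for the fixed element, divided by its leading monomial.
      have h1 : D m * (1 + F ((R.map (mono b)).sum) v) = 1 + (R.map (mono b)).sum v := by
        have h2 := congrFun hfix v
        rw [map_mul, map_add, map_one, Pi.mul_apply, Pi.mul_apply, Pi.add_apply, Pi.add_apply,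
          Pi.one_apply, hFD] at h2
        have h3 := congrArg (monomial b v (-m) * ·) h2
        change _ = monomial b v (-m) * (monomial b v m * _) at h3
        rw [← mul_assoc (monomial b v (-m)) (monomial b v m), hcancel, one_mul] at h3
        rw [← h3]
        calc _ = (monomial b v (-m) * monomial b v m) * (D m *
              (1 + F ((R.map (mono b)).sum) v)) := by rw [hcancel, one_mul]
          _ = _ := by ring
      -- Each term is r - D(m) F(r) = -(D(m r) - 1) r. The first factor has height k by induction
      -- and `r` adds at least 1.
      have h4 : ∀ L : List (Mono b), (∀ r ∈ L, monomial b v r ∈ heightFiltration b v 1) →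
          (L.map (mono b)).sum v - D m * F ((L.map (mono b)).sum) v ∈
            heightFiltration b v (k + 1) := by
        intro L hL
        induction L with
        | nil =>
          rw [List.map_nil, List.sum_nil, map_zero, Pi.zero_apply, mul_zero, sub_zero]
          exact zero_mem _
        | cons r L ihL =>
          have h5 := ihL fun r' hr' => hL r' (List.mem_cons_of_mem _ hr')
          have h6 := neg_mem (mul_mem_heightFiltration (ih (m + r)) (hL r List.mem_cons_self))
          have h7 := add_mem h6 h5
          rw [List.map_cons, List.sum_cons, map_add, Pi.add_apply, Pi.add_apply, hFD]
          change monomial b v r + _ - _ ∈ _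
          rw [hDadd] at h7
          convert h7 using 1
          ring
      have h8 : D m - 1 = (R.map (mono b)).sum v - D m * F ((R.map (mono b)).sum) v := by
        linear_combination h1
      rw [h8]
      exact h4 R hR
    | zero =>
      rw [hD0, sub_self]
      exact zero_mem _
    | add m n _ _ hm hn =>
      have := add_mem (mul_mem_heightFiltration hm (hDmem n)) hn
      rw [hDadd]
      convert this using 1
      ring
    | neg m _ hm =>
      have h1 := neg_mem (mul_mem_heightFiltration hm (hDmem (-m)))
      have h2 : D m * D (-m) = 1 := by rw [← hDadd, add_neg_cancel, hD0]
      convert h1 using 1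
      linear_combination h2

/-! ### `Θ_i` is an involution -/

lemma mem_of_Y_mem {b : P.Base} {S : AddSubgroup (Mono b)} {m : Mono b}
    (h : ∀ j a, m (j, a) ≠ 0 → Y b j a ∈ S) : m ∈ S := by
  rw [← m.sum_single]
  refine sum_mem fun p hp => ?_
  have := zsmul_mem (h p.1 p.2 (Finsupp.mem_support_iff.1 hp)) (m p)
  simpa [Y] using this

lemma closure_Y_eq_top (b : P.Base) :
    AddSubgroup.closure (Set.range fun p : b.support × ℂˣ => Y b p.1 p.2) = ⊤ :=
  (AddSubgroup.eq_top_iff' _).2 fun _ => mem_of_Y_mem fun j a _ =>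
    AddSubgroup.subset_closure ⟨(j, a), rfl⟩

lemma simpleRefl_mul_self (b : P.Base) (i : b.support) : simpleRefl b i * simpleRefl b i = 1 := by
  apply Subtype.ext
  change RootPairing.Equiv.reflection P i * RootPairing.Equiv.reflection P i = 1
  rw [mul_eq_one_iff_inv_eq, RootPairing.Equiv.reflection_inv]

/-- Rigidity is applied to Y_{j,a} for j ≠ i and to the two-term invariants Y_{i,a}(1 +
A_{i,aq_i}^{-1}). Which of the two terms leads depends on the sign of v(α_i). -/
theorem thetaHom_mul_self (b : P.Base) (d : b.support → ℕ) (q : ℂˣ) (i : b.support) :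
    thetaHom b d q i * thetaHom b d q i = 1 := by
  have hF : IsTwisted b 1 (thetaHom b d q i * thetaHom b d q i) := by
    rw [← simpleRefl_mul_self b i]
    exact (isTwisted_thetaHom b d q i).comp (isTwisted_thetaHom b d q i)
  have hinv : ∀ x ∈ invariants b d q i, (thetaHom b d q i * thetaHom b d q i) x = x := by
    intro x hx
    have := mem_invariants.1 hx
    change thetaHom b d q i (thetaHom b d q i x) = x
    rw [this, this]
  ext1 x
  funext v
  rcases smul_root_pos_or_neg b v i with hv | hv
  · refine hF.eq_of_generators _ (closure_Y_eq_top b) ?_ x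
    rintro _ ⟨⟨j, a⟩, rfl⟩
    by_cases hj : j = i
    · subst hj
      refine ⟨[-A b d q j (a * q ^ d j)], ?_, hinv _ ?_⟩
      · simpa using monomial_neg_A_mem d q hv _
      · simpa using string_one_mem_invariants d q (part_Y_same b j a)
    · exact ⟨[], by simp, by
        simpa using hinv _ (mono_mem_invariants d q (part_Y_ne b hj a))⟩
  -- When v(α_i) is negative the leading term is Y_{i,a} A_{i,aq_i}^{-1}, so these monomials replace
  -- the Y_{i,a} as generators.
  · refine hF.eq_of_generators ({m | ∃ j a, j ≠ i ∧ m = Y b j a} ∪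
      {m | ∃ a, m = Y b i a - A b d q i (a * q ^ d i)}) ?_ ?_ x
    · rw [← top_le_iff, ← closure_Y_eq_top, AddSubgroup.closure_le]
      rintro _ ⟨⟨j, a⟩, rfl⟩
      by_cases hj : j = i
      · subst hj
        set T := AddSubgroup.closure ({m | ∃ k c, k ≠ j ∧ m = Y b k c} ∪
          {m | ∃ c, m = Y b j c - A b d q j (c * q ^ d j)})
        have h1 : Y b j (a * ((q ^ d j) ^ 2)⁻¹) - A b d q j (a * (q ^ d j)⁻¹) ∈ T := by
          refine AddSubgroup.subset_closure (Or.inr ⟨a * ((q ^ d j) ^ 2)⁻¹, ?_⟩)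
          rw [mul_assoc]
          congr 3
          group
        -- A_{j,aq_j^{-1}} contains Y_{j,a} Y_{j,aq_j^{-2}}, so the generator of parameter a
        -- q_j^{-2} equals Y_{j,a}^{-1} up to variables of other nodes.
        have h2 : Y b j a + (Y b j (a * ((q ^ d j) ^ 2)⁻¹) - A b d q j (a * (q ^ d j)⁻¹)) ∈ T := by
          refine mem_of_Y_mem fun k c hk => AddSubgroup.subset_closure (Or.inl ⟨k, c, ?_, rfl⟩)
          rintro rfl
          apply hk
          rw [← part_apply, map_add, map_sub, part_A_self, part_Y_same, part_Y_same,
            inv_mul_cancel_right, mul_assoc, ← mul_inv, ← sq]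
          simp
        simpa using sub_mem h2 h1
      · exact AddSubgroup.subset_closure (Or.inl ⟨j, a, hj, rfl⟩)
    · rintro _ (⟨j, a, hj, rfl⟩ | ⟨a, rfl⟩)
      · exact ⟨[], by simp, by
          simpa using hinv _ (mono_mem_invariants d q (part_Y_ne b hj a))⟩
      · refine ⟨[A b d q i (a * q ^ d i)], ?_, hinv _ ?_⟩
        · simpa using monomial_A_mem d q hv _
        · have := string_one_mem_invariants d q (part_Y_same b i a)
          rw [mul_add, mul_one, ← mono_add] at this
          simp only [List.map_cons, List.map_nil, List.sum_cons, List.sum_nil, add_zero]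
          rw [mul_add, mul_one, ← mono_add, sub_add_cancel, sub_eq_add_neg, add_comm]
          exact this

variable [P.IsReduced]

/-! ### Words in the simple reflections -/

lemma weylGroup_ext {g h : P.weylGroup} (H : ∀ x : M, g • x = h • x) : g = h := by
  apply Subtype.ext
  apply RootPairing.Equiv.weightHom_injective P
  ext x
  exact H x

/-- The conjugation rule w s_α w⁻¹ = s_{w(α)}; it suffices to check it for reflections. -/
lemma mul_ofIdx (w : P.weylGroup) {i j : ι} (h : w • P.root i = P.root j) :
    w * RootPairing.weylGroup.ofIdx P i = RootPairing.weylGroup.ofIdx P j * w := by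
  obtain ⟨g, hg⟩ := w
  induction hg using RootPairing.weylGroup.induction generalizing i j with
  | mem k =>
    refine weylGroup_ext fun x => ?_
    have h1 : P.reflectionPerm k i = j := P.root.injective (by
      rw [P.root_reflectionPerm]
      exact h)
    subst h1
    change P.reflection k (P.reflection i x) =
      P.reflection (P.reflectionPerm k i) (P.reflection k x)
    rw [P.reflection_reflectionPerm]
    simp
  | one =>
    have h1 : i = j := P.root.injective h
    subst h1
    exact weylGroup_ext fun x => rfl
  | mul x y hx hy h1 h2 =>
    have h3 := RootPairing.weylGroup_apply_root P (⟨y, hy⟩ : P.weylGroup) i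
    have h4 : (⟨x, hx⟩ : P.weylGroup) • P.root (P.weylGroupToPerm ⟨y, hy⟩ i) = P.root j := by
      rw [← h3, ← mul_smul]
      exact h
    have e : (⟨x * y, mul_mem hx hy⟩ : P.weylGroup) = ⟨x, hx⟩ * ⟨y, hy⟩ := rfl
    rw [e, mul_assoc, h2 h3, ← mul_assoc, h1 h4, mul_assoc]

/-- The product of a word in the simple reflections. -/
def wordProd (b : P.Base) (l : List b.support) : P.weylGroup := (l.map (simpleRefl b)).prod

lemma wordProd_nil (b : P.Base) : wordProd b [] = 1 := rfl

lemma wordProd_cons (b : P.Base) (i : b.support) (l : List b.support) :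
    wordProd b (i :: l) = simpleRefl b i * wordProd b l := by
  simp [wordProd]

lemma wordProd_append (b : P.Base) (l l' : List b.support) :
    wordProd b (l ++ l') = wordProd b l * wordProd b l' := by
  simp [wordProd]

lemma wordProd_mul_reverse (b : P.Base) (l : List b.support) :
    wordProd b l * wordProd b l.reverse = 1 := by
  induction l with
  | nil => rfl
  | cons i l ih =>
    rw [List.reverse_cons, wordProd_append, wordProd_cons, wordProd_cons, wordProd_nil, mul_one,
      mul_assoc, ← mul_assoc (wordProd b l), ih, one_mul, simpleRefl_mul_self]

lemma wordProd_reverse (b : P.Base) (l : List b.support) :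
    wordProd b l.reverse = (wordProd b l)⁻¹ :=
  eq_inv_of_mul_eq_one_right (wordProd_mul_reverse b l)

/-- The group is generated by all reflections. Every root arises from simple ones by sign changes
and simple reflections, so each reflection is a conjugate of a simple one. -/
lemma exists_word (b : P.Base) (w : P.weylGroup) : ∃ l, wordProd b l = w := by
  obtain ⟨g, hg⟩ := w
  induction hg using RootPairing.weylGroup.induction with
  | mem i =>
    change ∃ l, wordProd b l = RootPairing.weylGroup.ofIdx P i
    induction i using b.induction_reflect with
    | h₀ i ih =>
      obtain ⟨l, hl⟩ := ih
      refine ⟨l, hl.trans ?_⟩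
      have := mul_ofIdx (RootPairing.weylGroup.ofIdx P i) (i := i) (j := P.reflectionPerm i i)
        (P.root_reflectionPerm i i).symm
      exact mul_right_cancel this
    | h₁ i hi => exact ⟨[⟨i, hi⟩], by rw [wordProd_cons, wordProd_nil, mul_one]; rfl⟩
    | h₂ i j ih hj =>
      obtain ⟨l, hl⟩ := ih
      refine ⟨⟨j, hj⟩ :: (l ++ [⟨j, hj⟩]), ?_⟩
      have := mul_ofIdx (RootPairing.weylGroup.ofIdx P j) (i := i) (j := P.reflectionPerm j i)
        (P.root_reflectionPerm j i).symm
      rw [wordProd_cons, wordProd_append, wordProd_cons, wordProd_nil, mul_one, hl, ← mul_assoc]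
      have h2 : simpleRefl b ⟨j, hj⟩ = RootPairing.weylGroup.ofIdx P j := rfl
      rw [h2, this, mul_assoc, ← h2, simpleRefl_mul_self, mul_one]
  | one => exact ⟨[], rfl⟩
  | mul x y hx hy h1 h2 =>
    obtain ⟨l, hl⟩ := h1
    obtain ⟨l', hl'⟩ := h2
    exact ⟨l ++ l', by rw [wordProd_append, hl, hl']; rfl⟩

/-! ### Positive roots, exchange and descents. -/

lemma root_mem_posCone (b : P.Base) (i : b.support) : P.root i ∈ posCone b :=
  AddSubmonoid.subset_closure ⟨i, i.2, rfl⟩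

lemma isPos_of_mem_posCone {b : P.Base} {k : ι} (h : P.root k ∈ posCone b) : b.IsPos k := by
  obtain ⟨n, hn⟩ := (mem_posCone_iff b _).1 h
  rw [RootPairing.Base.isPos_iff', RootPairing.Base.height_eq_sum
    (f := fun j => if h : j ∈ b.support then (n ⟨j, h⟩ : ℤ) else 0)]
  · refine Finset.sum_nonneg fun j _ => ?_
    split_ifs
    positivity
  · rw [hn, coneSum, ← Finset.sum_coe_sort b.support]
    exact Finset.sum_congr rfl fun j _ => by simp

lemma isPos_iff_mem_posCone {b : P.Base} {k : ι} : b.IsPos k ↔ P.root k ∈ posCone b := by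
  refine ⟨fun h => ?_, isPos_of_mem_posCone⟩
  refine (b.root_mem_or_neg_mem k).resolve_right fun hneg => ?_
  let := P.indexNeg
  have h1 : P.root (-k) ∈ posCone b := by simpa using! hneg
  exact (RootPairing.Base.IsPos.neg_iff_not b k).1 (isPos_of_mem_posCone h1) h

lemma smul_root_mem_or_not {b : P.Base} {w : P.weylGroup} {i : ι} :
    w • P.root i ∉ posCone b ↔ -(w • P.root i) ∈ posCone b := by
  refine ⟨(smul_root_pos_or_neg b w i).resolve_left, fun h h' => ?_⟩
  have h0 := (smul_eq_zero_iff_eq w).1 (eq_zero_of_mem_neg_mem b h' h)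
  exact P.ne_zero i h0

lemma simpleRefl_smul_root_self (b : P.Base) (i : b.support) :
    simpleRefl b i • P.root i = -P.root i := by
  change P.reflection i (P.root i) = _
  simp

/-- The exchange property. -/
lemma exists_word_mul_simpleRefl {b : P.Base} (l : List b.support) (i : b.support)
    (h : wordProd b l • P.root i ∉ posCone b) :
    ∃ l' : List b.support, l'.length + 1 = l.length ∧
      wordProd b l * simpleRefl b i = wordProd b l' := by
  induction l with
  | nil =>
    rw [wordProd_nil, one_smul] at h
    exact absurd (root_mem_posCone b i) h
  | cons j l ih =>
    by_cases h' : wordProd b l • P.root i ∈ posCone b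
    · have hk := RootPairing.weylGroup_apply_root P (wordProd b l) (i : ι)
      set k := P.weylGroupToPerm (wordProd b l) i
      -- α_j is the only positive root that s_j makes negative. Then s_j l = l s_i by conjugation,
      -- and multiplying by s_i deletes the letter `j`.
      have hkj : k = j := by
        by_contra hne
        have h1 := RootPairing.Base.IsPos.reflectionPerm
          (isPos_iff_mem_posCone.2 (hk ▸ h' : P.root k ∈ posCone b)) j.2 hne
        rw [isPos_iff_mem_posCone, P.root_reflectionPerm] at h1
        rw [wordProd_cons, mul_smul, hk] at h
        exact h h1
      rw [hkj] at hk
      refine ⟨l, rfl, ?_⟩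
      have h2 := mul_ofIdx _ hk
      change wordProd b l * simpleRefl b i = simpleRefl b j * wordProd b l at h2
      rw [wordProd_cons, mul_assoc, h2, ← mul_assoc, simpleRefl_mul_self, one_mul]
    · obtain ⟨l', hl', e⟩ := ih h'
      exact ⟨j :: l', by simp [hl'], by rw [wordProd_cons, wordProd_cons, mul_assoc, e]⟩

/-- The length of an element of the Weyl group. -/
def len (b : P.Base) (w : P.weylGroup) : ℕ := sInf {n | ∃ l, wordProd b l = w ∧ l.length = n}

lemma exists_reduced_word (b : P.Base) (w : P.weylGroup) :
    ∃ l, wordProd b l = w ∧ l.length = len b w := by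
  obtain ⟨l, hl⟩ := exists_word b w
  exact Nat.sInf_mem (s := {n | ∃ l, wordProd b l = w ∧ l.length = n}) ⟨_, l, hl, rfl⟩

lemma len_le (b : P.Base) (l : List b.support) : len b (wordProd b l) ≤ l.length :=
  Nat.sInf_le ⟨l, rfl, rfl⟩

lemma len_mul_lt {b : P.Base} {w : P.weylGroup} {i : b.support}
    (h : w • P.root i ∉ posCone b) : len b (w * simpleRefl b i) < len b w := by
  obtain ⟨l, rfl, hl⟩ := exists_reduced_word b w
  obtain ⟨l', hl', e⟩ := exists_word_mul_simpleRefl l i h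
  have := len_le b l'
  rw [e]
  omega

lemma mul_simpleRefl_smul_root_not_mem {b : P.Base} {w : P.weylGroup} {i : b.support}
    (h : w • P.root i ∈ posCone b) : (w * simpleRefl b i) • P.root i ∉ posCone b := by
  rw [smul_root_mem_or_not, mul_smul, simpleRefl_smul_root_self, smul_neg, neg_neg]
  exact h

/-- If a reduced word of `w` ended in s_i, deleting that letter would shorten `w`, whereas
positivity of w(α_i) says that w s_i is longer than `w`. -/
lemma eq_one_of_forall_mem {b : P.Base} {w : P.weylGroup}
    (h : ∀ i : b.support, w • P.root i ∈ posCone b) : w = 1 := by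
  obtain ⟨l, hl, hlen⟩ := exists_reduced_word b w
  rcases List.eq_nil_or_concat l with rfl | ⟨l', i, rfl⟩
  · exact hl.symm
  · exfalso
    rw [List.concat_eq_append, wordProd_append, wordProd_cons, wordProd_nil, mul_one] at hl
    have h1 := len_mul_lt (mul_simpleRefl_smul_root_not_mem (h i))
    rw [mul_assoc, simpleRefl_mul_self, mul_one] at h1
    have h2 := len_le b l'
    rw [← hl, mul_assoc, simpleRefl_mul_self, mul_one, hl] at h1
    simp at hlen
    omega

/-! ### Cosets of rank two parabolic subgroups -/

/-- `w` is the minimal element of its coset of the parabolic subgroup of `{i, j}`. -/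
def IsMinimal (b : P.Base) (i j : b.support) (w : P.weylGroup) : Prop :=
  w • P.root i ∈ posCone b ∧ w • P.root j ∈ posCone b

/-- Elements of the parabolic subgroup change only the α_i and α_j coordinates; this is how the
coordinates at other nodes are controlled below. -/
lemma smul_sub_mem_span {b : P.Base} {i j : b.support} {p : List b.support}
    (hp : ∀ k ∈ p, k = i ∨ k = j) (x : M) :
    wordProd b p • x - x ∈ Submodule.span ℂ {P.root i, P.root j} := by
  induction p generalizing x with
  | nil => simp [wordProd_nil]
  | cons k p ih =>
    have h1 := ih (fun k' hk' => hp k' (List.mem_cons_of_mem _ hk')) x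
    have h2 : ∀ y : M, simpleRefl b k • y - y ∈ Submodule.span ℂ {P.root i, P.root j} := by
      intro y
      change P.reflection k y - y ∈ _
      rw [RootPairing.reflection_apply, sub_sub_cancel_left]
      refine neg_mem (Submodule.smul_mem _ _ (Submodule.subset_span ?_))
      rcases hp k List.mem_cons_self with rfl | rfl <;> simp
    have := add_mem (h2 (wordProd b p • x)) h1
    rwa [sub_add_sub_cancel, ← mul_smul, ← wordProd_cons] at this

lemma repr_eq_zero_of_mem_span {b : P.Base} {i j k : b.support} (hi : k ≠ i) (hj : k ≠ j) {x : M}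
    (hx : x ∈ Submodule.span ℂ {P.root i, P.root j}) : b.toWeightBasis.repr x k = 0 := by
  obtain ⟨s, t, rfl⟩ := Submodule.mem_span_pair.1 hx
  simp [RootPairing.Base.toWeightBasis_repr_root, hi.symm, hj.symm]

lemma repr_coneSum (b : P.Base) (n : b.support → ℕ) (k : b.support) :
    b.toWeightBasis.repr (coneSum b n) k = n k := by
  simp only [coneSum, map_sum, map_nsmul, RootPairing.Base.toWeightBasis_repr_root,
    Finsupp.coe_finsetSum, Finset.sum_apply, Finsupp.smul_apply, Finsupp.single_apply]
  simp

/-- Uniqueness of the minimal element of a coset. If the parabolic element u made α_i or α_j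
negative, the result would be a negative combination of α_i and α_j alone; `w` keeps it negative,
against the minimality of w u. So u has no descents. -/
lemma IsMinimal.wordProd_eq_one {b : P.Base} {i j : b.support} {w : P.weylGroup}
    (hw : IsMinimal b i j w) {p : List b.support} (hp : ∀ k ∈ p, k = i ∨ k = j)
    (hwp : IsMinimal b i j (w * wordProd b p)) : wordProd b p = 1 := by
  have key : ∀ l : b.support, l = i ∨ l = j → wordProd b p • P.root l ∈ posCone b := by
    intro l hl
    by_contra hneg
    have hwl : (w * wordProd b p) • P.root l ∈ posCone b := by
      rcases hl with rfl | rfl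
      exacts [hwp.1, hwp.2]
    obtain ⟨n, hn⟩ := (mem_posCone_iff b _).1 (smul_root_mem_or_not.1 hneg)
    have hspan : wordProd b p • P.root l ∈ Submodule.span ℂ {P.root i, P.root j} := by
      have h1 := smul_sub_mem_span hp (P.root l)
      have h2 : P.root l ∈ Submodule.span ℂ {P.root i, P.root j} :=
        Submodule.subset_span (by rcases hl with rfl | rfl <;> simp)
      simpa using add_mem h1 h2
    have h0 : ∀ k, k ≠ i → k ≠ j → n k = 0 := by
      intro k hki hkj
      have h1 := repr_eq_zero_of_mem_span hki hkj (neg_mem hspan)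
      rw [hn, repr_coneSum] at h1
      exact_mod_cast h1
    have hpos : w • (-(wordProd b p • P.root l)) ∈ posCone b := by
      rw [hn, coneSum, Finset.smul_sum]
      refine sum_mem fun k _ => ?_
      rw [smul_nsmul]
      by_cases hki : k = i
      · subst hki
        exact nsmul_mem hw.1 _
      · by_cases hkj : k = j
        · subst hkj
          exact nsmul_mem hw.2 _
        · rw [h0 k hki hkj, zero_smul]
          exact zero_mem _
    rw [smul_neg, ← mul_smul] at hpos
    exact smul_root_mem_or_not.2 hpos hwl
  refine eq_one_of_forall_mem (b := b) fun k => ?_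
  by_cases hk : k = i ∨ k = j
  · exact key k hk
  · push Not at hk
    by_contra hneg
    obtain ⟨n, hn⟩ := (mem_posCone_iff b _).1 (smul_root_mem_or_not.1 hneg)
    have h1 := repr_eq_zero_of_mem_span hk.1 hk.2 (smul_sub_mem_span hp (P.root k))
    rw [map_sub, Finsupp.sub_apply, ← neg_neg (wordProd b p • P.root k), hn, map_neg,
      Finsupp.neg_apply, repr_coneSum, b.toWeightBasis_repr_root] at h1
    -- For a node k outside {i, j}, the α_k coordinate of the image of α_k is still 1, so the image
    -- cannot be negative.
    have h2 : ((n k + 1 : ℕ) : ℂ) = 0 := by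
      push_cast
      simp at h1
      linear_combination -h1
    exact Nat.succ_ne_zero _ (Nat.cast_eq_zero.1 h2)

/-- Removing descents in {i, j} lowers the length, so the process stops at a minimal element. -/
lemma exists_isMinimal (b : P.Base) (i j : b.support) (w : P.weylGroup) :
    ∃ p : List b.support, (∀ k ∈ p, k = i ∨ k = j) ∧ IsMinimal b i j (w * wordProd b p) := by
  induction hn : len b w using Nat.strong_induction_on generalizing w with
  | _ n ih =>
    by_cases hw : ∃ k, (k = i ∨ k = j) ∧ w • P.root k ∉ posCone b
    · obtain ⟨k, hk, hneg⟩ := hw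
      obtain ⟨p, hp, hmin⟩ := ih _ (hn ▸ len_mul_lt hneg) _ rfl
      refine ⟨k :: p, by simpa [hk] using hp, ?_⟩
      rwa [wordProd_cons, ← mul_assoc]
    · push Not at hw
      exact ⟨[], by simp, by rw [wordProd_nil, mul_one]; exact ⟨hw i (by simp), hw j (by simp)⟩⟩

/-! ### Extension of maps from the simple reflections to the Weyl group -/

section Extension

variable {E : Type*} [Monoid E]

/-- The candidate for the extension: the value at `w` is computed along a chosen chain of
descents. -/
def extend (b : P.Base) (θ : b.support → E) (w : P.weylGroup) : E :=
  if h : ∃ i : b.support, w • P.root i ∉ posCone b then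
    have : len b (w * simpleRefl b h.choose) < len b w := len_mul_lt h.choose_spec
    extend b θ (w * simpleRefl b h.choose) * θ h.choose
  else 1
termination_by len b w
decreasing_by exact this

variable {b : P.Base} {θ : b.support → E}

lemma prod_mul_prod_reverse (hθ : ∀ i, θ i * θ i = 1) (p : List b.support) :
    (p.map θ).prod * (p.reverse.map θ).prod = 1 := by
  induction p with
  | nil => simp
  | cons k p ih =>
    simp only [List.map_cons, List.prod_cons, List.reverse_cons, List.map_append, List.prod_append,
      List.map_nil, List.prod_nil, mul_one]
    rw [mul_assoc, ← mul_assoc (p.map θ).prod, ih, one_mul, hθ]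

lemma extend_one : extend b θ 1 = 1 := by
  rw [extend, dif_neg]
  rintro ⟨i, hi⟩
  rw [one_smul] at hi
  exact hi (root_mem_posCone b i)

/-- The definition follows one chosen descent; the point is that every other descent gives the same
value. Two descents i and j are compared through the minimal element of the coset of ⟨s_i, s_j⟩ that
contains `w`. -/
lemma extend_descent (hθ : ∀ i, θ i * θ i = 1)
    (hrank : ∀ i j : b.support, i ≠ j → ∀ p : List b.support, (∀ k ∈ p, k = i ∨ k = j) →
      wordProd b p = 1 → (p.map θ).prod = 1)
    {w : P.weylGroup} {i : b.support} (hi : w • P.root i ∉ posCone b) :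
    extend b θ w = extend b θ (w * simpleRefl b i) * θ i := by
  induction hn : len b w using Nat.strong_induction_on generalizing w i with
  | _ n ih =>
    have hex : ∃ i : b.support, w • P.root i ∉ posCone b := ⟨i, hi⟩
    rw [extend, dif_pos hex]
    have hj := hex.choose_spec
    set j := hex.choose
    by_cases hij : i = j
    · rw [hij]
    -- Below length n the value may be computed along any descents, in particular along those in {i,
    -- j} down to the minimal element of the coset.
    have hdesc : ∀ x : P.weylGroup, len b x < n → ∃ p : List b.support,
        (∀ k ∈ p, k = i ∨ k = j) ∧ IsMinimal b i j (x * wordProd b p) ∧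
          extend b θ x = extend b θ (x * wordProd b p) * (p.reverse.map θ).prod := by
      intro x hx
      induction hm : len b x using Nat.strong_induction_on generalizing x with
      | _ m ihm =>
        by_cases hk : ∃ k, (k = i ∨ k = j) ∧ x • P.root k ∉ posCone b
        · obtain ⟨k, hk, hneg⟩ := hk
          have hlt := len_mul_lt hneg
          obtain ⟨p, hp, hmin, he⟩ := ihm _ (hm ▸ hlt) _ (hlt.trans hx) rfl
          refine ⟨k :: p, by simpa [hk] using hp, ?_, ?_⟩
          · rwa [wordProd_cons, ← mul_assoc]
          · rw [ih _ hx hneg rfl, he, wordProd_cons, ← mul_assoc, List.reverse_cons,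
              List.map_append, List.prod_append, mul_assoc]
            simp
        · push Not at hk
          exact ⟨[], by simp, by
            rw [wordProd_nil, mul_one]
            exact ⟨hk i (by simp), hk j (by simp)⟩, by simp [wordProd_nil]⟩
    obtain ⟨p, hp, hpm, hpe⟩ := hdesc _ (hn ▸ len_mul_lt hi)
    obtain ⟨r, hr, hrm, hre⟩ := hdesc _ (hn ▸ len_mul_lt hj)
    -- The closed path from the minimal element below w s_i up to `w`, and down through w s_j to the
    -- minimal element there.
    set c := p.reverse ++ (i :: j :: r) with hc
    have hcmem : ∀ k ∈ c, k = i ∨ k = j := by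
      intro k hk
      simp only [hc, List.mem_append, List.mem_reverse, List.mem_cons] at hk
      rcases hk with hk | rfl | rfl | hk
      exacts [hp k hk, Or.inl rfl, Or.inr rfl, hr k hk]
    have hprod : w * simpleRefl b i * wordProd b p * wordProd b c =
        w * simpleRefl b j * wordProd b r := by
      rw [hc, wordProd_append, wordProd_cons, wordProd_cons, ← mul_assoc,
        mul_assoc _ (wordProd b p), wordProd_mul_reverse, mul_one, mul_assoc w,
        ← mul_assoc (simpleRefl b i), simpleRefl_mul_self, one_mul, mul_assoc]
    -- Both ends are minimal in the same coset, hence equal, so the rank two hypothesis applies to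
    -- `c`.
    have hc1 : wordProd b c = 1 := hpm.wordProd_eq_one hcmem (by rwa [hprod])
    rw [hc1, mul_one] at hprod
    have hθc := hrank i j hij c hcmem hc1
    rw [hre, hpe, hprod, mul_assoc (extend b θ _), mul_assoc (extend b θ _)]
    congr 1
    rw [hc, List.map_append, List.prod_append, List.map_cons, List.map_cons, List.prod_cons,
      List.prod_cons] at hθc
    have h1 := prod_mul_prod_reverse hθ r
    calc (r.reverse.map θ).prod * θ j
        = (p.reverse.map θ).prod * (θ i * (θ j * (r.map θ).prod)) *
            ((r.reverse.map θ).prod * θ j) := by rw [hθc, one_mul]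
      _ = (p.reverse.map θ).prod * (θ i * (θ j * ((r.map θ).prod * (r.reverse.map θ).prod) *
            θ j)) := by simp only [mul_assoc]
      _ = _ := by rw [h1, mul_one, hθ, mul_one]

lemma extend_mul_simpleRefl (hθ : ∀ i, θ i * θ i = 1)
    (hrank : ∀ i j : b.support, i ≠ j → ∀ p : List b.support, (∀ k ∈ p, k = i ∨ k = j) →
      wordProd b p = 1 → (p.map θ).prod = 1) (w : P.weylGroup) (i : b.support) :
    extend b θ (w * simpleRefl b i) = extend b θ w * θ i := by
  by_cases hi : w • P.root i ∈ posCone b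
  · rw [extend_descent hθ hrank (mul_simpleRefl_smul_root_not_mem hi), mul_assoc w,
      simpleRefl_mul_self, mul_one]
  · rw [extend_descent hθ hrank hi, mul_assoc, hθ, mul_one]

/-- A map on the simple reflections that satisfies the rank two relations extends to the Weyl
group. -/
theorem exists_monoidHom_of_rank_two (hθ : ∀ i, θ i * θ i = 1)
    (hrank : ∀ i j : b.support, i ≠ j → ∀ p : List b.support, (∀ k ∈ p, k = i ∨ k = j) →
      wordProd b p = 1 → (p.map θ).prod = 1) :
    ∃ ρ : P.weylGroup →* E, ∀ i, ρ (simpleRefl b i) = θ i := by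
  have hstep := extend_mul_simpleRefl hθ hrank
  refine ⟨⟨⟨extend b θ, extend_one⟩, fun w w' => ?_⟩, fun i => ?_⟩
  · obtain ⟨l, rfl⟩ := exists_word b w'
    change extend b θ (w * wordProd b l) = extend b θ w * extend b θ (wordProd b l)
    induction l using List.reverseRecOn with
    | nil => rw [wordProd_nil, mul_one, extend_one, mul_one]
    | append_singleton l i ih =>
      rw [wordProd_append, wordProd_cons, wordProd_nil, mul_one, ← mul_assoc, hstep, hstep, ih,
        mul_assoc]
  · change extend b θ (simpleRefl b i) = θ i
    have := hstep 1 i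
    rwa [one_mul, extend_one, one_mul] at this

end Extension

/-! ### Strings -/

/-- The monomial `A_{k, a p^n}^{-1}`. -/
def lower (b : P.Base) (d : b.support → ℕ) (q p a : ℂˣ) (k : b.support) (n : ℤ) : Mono b :=
  -A b d q k (a * p ^ n)

/-- The part of `Y_{k, a p^n}`. -/
def pt (p a : ℂˣ) (n : ℤ) : ℂˣ →₀ ℤ := Finsupp.single (a * p ^ n) 1

section Strings

variable {b : P.Base} {d : b.support → ℕ} {q p a : ℂˣ} {i j : b.support} {s : ℤ}

lemma part_lower_self (hs : q ^ d i = p ^ s) (n : ℤ) :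
    part b i (lower b d q p a i n) = -(pt p a (n - s) + pt p a (n + s)) := by
  rw [lower, map_neg, part_A_self, hs, mul_assoc, mul_assoc, ← zpow_neg, ← zpow_add, ← zpow_add]
  rfl

lemma part_A (b : P.Base) (d : b.support → ℕ) (q : ℂˣ) {i j : b.support} (hij : i ≠ j) (a : ℂˣ) :
    part b j (A b d q i a) = -((if cartan b j i = -1 then Finsupp.single a 1 else 0) +
      (if cartan b j i = -2 then
        Finsupp.single (a * q⁻¹) 1 + Finsupp.single (a * q) 1 else 0) +
      (if cartan b j i = -3 then Finsupp.single (a * (q ^ 2)⁻¹) 1 + Finsupp.single a 1 +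
        Finsupp.single (a * q ^ 2) 1 else 0)) := by
  have hY : ∀ k c, part b j (Y b k c) = if j = k then Finsupp.single c 1 else 0 := by
    intro k c
    split_ifs with h
    · rw [← h, part_Y_same]
    · exact part_Y_ne b (Ne.symm h) c
  simp only [A, map_sub, map_add, map_sum, hY, hij.symm, if_false, Finset.sum_add_distrib,
    Finset.sum_ite_eq, Finset.mem_filter, Finset.mem_univ, true_and]
  split_ifs <;> simp

lemma part_lower_zero (hij : i ≠ j) (hc : cartan b j i = 0) (n : ℤ) :
    part b j (lower b d q p a i n) = 0 := by
  rw [lower, map_neg, part_A b d q hij, hc]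
  simp

lemma part_lower_one (hij : i ≠ j) (hc : cartan b j i = -1) (n : ℤ) :
    part b j (lower b d q p a i n) = pt p a n := by
  rw [lower, map_neg, part_A b d q hij, hc]
  simp [pt]

lemma part_lower_two (hij : i ≠ j) (hc : cartan b j i = -2) (n : ℤ) :
    part b j (lower b d q q a i n) = pt q a (n - 1) + pt q a (n + 1) := by
  rw [lower, map_neg, part_A b d q hij, hc, pt, pt, sub_eq_add_neg, zpow_add, zpow_add,
    ← mul_assoc, ← mul_assoc]
  simp

lemma part_lower_three (hij : i ≠ j) (hc : cartan b j i = -3) (n : ℤ) :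
    part b j (lower b d q q a i n) = pt q a (n - 2) + pt q a n + pt q a (n + 2) := by
  rw [lower, map_neg, part_A b d q hij, hc, pt, pt, pt, sub_eq_add_neg, zpow_add, zpow_add,
    ← mul_assoc, ← mul_assoc]
  simp

lemma part_Y_pt (n : ℤ) : part b i (Y b i (a * p ^ n)) = pt p a n := part_Y_same b i _

lemma string_one (hs : q ^ d i = p ^ s) {m : Mono b} {n : ℤ} (h : part b i m = pt p a n) :
    mono b m * (1 + mono b (lower b d q p a i (n + s))) ∈ invariants b d q i := by
  have := string_one_mem_invariants d q h
  rwa [hs, mul_assoc, ← zpow_add] at this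

/-- A product of two doublets, four terms in all. The two parameters are arbitrary. -/
lemma string_pair (hs : q ^ d i = p ^ s) {m : Mono b} {n n' : ℤ}
    (h : part b i m = pt p a n + pt p a n') :
    mono b m * ((1 + mono b (lower b d q p a i (n + s))) *
      (1 + mono b (lower b d q p a i (n' + s)))) ∈ invariants b d q i := by
  have h1 := string_one hs (part_Y_pt (b := b) (i := i) (p := p) (a := a) n)
  have h2 := string_one (m := m - Y b i (a * p ^ n)) (n := n') hs
    (by rw [map_sub, h, part_Y_pt]; abel)
  convert mul_mem h1 h2 using 1
  have h3 : mono b m = mono b (Y b i (a * p ^ n)) * mono b (m - Y b i (a * p ^ n)) := by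
    rw [← mono_add]
    congr 1
    abel
  rw [h3]
  ring

/-- For parameters in the ratio q_i² the product of two doublets contains a monomial free of
Y_{i,c}, because A_{i,aq_i} cancels Y_{i,a} Y_{i,aq_i²}. Subtracting this invariant term leaves the
triplet. -/
lemma string_two (hs : q ^ d i = p ^ s) {m : Mono b} {n : ℤ}
    (h : part b i m = pt p a n + pt p a (n + 2 * s)) :
    mono b m * (1 + mono b (lower b d q p a i (n + 3 * s)) *
      (1 + mono b (lower b d q p a i (n + s)))) ∈ invariants b d q i := by
  have h1 := string_pair hs h
  have h2 := mono_mem_invariants (m := m + lower b d q p a i (n + s)) d q (i := i) (by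
    rw [map_add, h, part_lower_self hs, show n + s - s = n by ring,
      show n + s + s = n + 2 * s by ring, add_neg_cancel])
  rw [show n + 2 * s + s = n + 3 * s by ring] at h1
  convert sub_mem h1 h2 using 1
  rw [mono_add]
  ring

/-- Doublet times triplet, minus the doublet that splits off: four terms remain. -/
lemma string_three (hs : q ^ d i = p ^ s) {m : Mono b} {n : ℤ}
    (h : part b i m = pt p a n + pt p a (n + 2 * s) + pt p a (n + 4 * s)) :
    mono b m * (1 + mono b (lower b d q p a i (n + 5 * s)) *
      (1 + mono b (lower b d q p a i (n + 3 * s)) *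
        (1 + mono b (lower b d q p a i (n + s))))) ∈ invariants b d q i := by
  have h1 := string_one hs (part_Y_pt (b := b) (i := i) (p := p) (a := a) n)
  have h2 := string_two (m := m - Y b i (a * p ^ n)) (n := n + 2 * s) hs
    (by
      rw [map_sub, h, part_Y_pt, show n + 2 * s + 2 * s = n + 4 * s by ring]
      abel)
  have h3 := string_one (m := m + lower b d q p a i (n + s)) (n := n + 4 * s) hs (by
    rw [map_add, h, part_lower_self hs, show n + s - s = n by ring,
      show n + s + s = n + 2 * s by ring]
    abel)
  rw [show n + 2 * s + 3 * s = n + 5 * s by ring, show n + 2 * s + s = n + 3 * s by ring] at h2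
  rw [show n + 4 * s + s = n + 5 * s by ring] at h3
  convert sub_mem (mul_mem h1 h2) h3 using 1
  have h4 : mono b m = mono b (Y b i (a * p ^ n)) * mono b (m - Y b i (a * p ^ n)) := by
    rw [← mono_add]
    congr 1
    abel
  rw [mono_add, h4]
  ring

end Strings

/-! ### Invariants with a given leading monomial -/

/-- The monomial has negative `v`-twisted weight for all minimal coset representatives `v`. -/
def IsLow (b : P.Base) (i j : b.support) (r : Mono b) : Prop :=
  ∀ v, IsMinimal b i j v → monomial b v r ∈ heightFiltration b v 1

section Characters

variable {b : P.Base} {d : b.support → ℕ} {q p a : ℂˣ} {i j : b.support}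

lemma IsLow.left (n : ℤ) : IsLow b i j (lower b d q p a i n) :=
  fun _ hv => monomial_neg_A_mem d q hv.1 _

lemma IsLow.right (n : ℤ) : IsLow b i j (lower b d q p a j n) :=
  fun _ hv => monomial_neg_A_mem d q hv.2 _

lemma IsLow.add {r r' : Mono b} (h : IsLow b i j r) (h' : IsLow b i j r') :
    IsLow b i j (r + r') := by
  intro v hv n hn
  rw [← monomial_mul] at hn
  obtain ⟨c, hc, hc'⟩ := mul_mem_heightFiltration (h v hv) (h' v hv) n hn
  exact ⟨c, hc, by omega⟩

lemma IsLow.symm {r : Mono b} (h : IsLow b i j r) : IsLow b j i r := fun v hv => h v hv.symm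

/-- There is a common invariant of `Θ_i` and `Θ_j` with leading monomial `m`. -/
def HasCharacter (b : P.Base) (d : b.support → ℕ) (q : ℂˣ) (i j : b.support) (m : Mono b) : Prop :=
  ∃ R : List (Mono b), (∀ r ∈ R, IsLow b i j r) ∧
    mono b m * (1 + (R.map (mono b)).sum) ∈ invariants b d q i ∧
    mono b m * (1 + (R.map (mono b)).sum) ∈ invariants b d q j

lemma HasCharacter.symm {m : Mono b} (h : HasCharacter b d q i j m) : HasCharacter b d q j i m := by
  obtain ⟨R, h1, h2, h3⟩ := h
  exact ⟨R, fun r hr => (h1 r hr).symm, h3, h2⟩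

/-- Type A₁×A₁: A_{i,c} contains no Y_{j,c'}, so Θ_j fixes both terms of the doublet of Θ_i. -/
lemma hasCharacter_of_cartan_eq_zero (hij : i ≠ j) (hc : cartan b j i = 0) (a : ℂˣ) :
    HasCharacter b d q i j (Y b i a) := by
  have hs : q ^ d i = (q ^ d i) ^ (1 : ℤ) := (zpow_one _).symm
  refine ⟨[lower b d q (q ^ d i) a i 1], by simpa using IsLow.left 1, ?_, ?_⟩
  · simpa using string_one (n := 0) hs (part_Y_same b i a ▸ by simp [pt])
  · simp only [List.map_cons, List.map_nil, List.sum_cons, List.sum_nil, add_zero, mul_add,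
      mul_one, ← mono_add]
    refine add_mem (mono_mem_invariants d q (part_Y_ne b hij a)) (mono_mem_invariants d q ?_)
    rw [map_add, part_Y_ne b hij, part_lower_zero hij hc, add_zero]

/-- The q-character of the three-dimensional fundamental representation, and the pattern for the
other types: the monomials form a doublet and a singlet for i, a singlet and a doublet for j. The
base is p = q_i rather than q because an A₂ edge may join long roots. -/
lemma hasCharacter_A_two (hij : i ≠ j) (hc : cartan b j i = -1) (hc' : cartan b i j = -1)
    (hd : d i = d j) (a : ℂˣ) : HasCharacter b d q i j (Y b i a) := by
  obtain ⟨p, hp⟩ : ∃ p, p = q ^ d i := ⟨_, rfl⟩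
  have hi : q ^ d i = p ^ (1 : ℤ) := by rw [hp, zpow_one]
  have hj : q ^ d j = p ^ (1 : ℤ) := by rw [← hd, hi]
  have hY : part b i (Y b i a) = pt p a 0 := by rw [part_Y_same, pt]; simp
  have hY' : part b j (Y b i a) = 0 := part_Y_ne b hij a
  have ii := part_lower_self (a := a) hi
  have jj := part_lower_self (a := a) hj
  have ji := part_lower_one (d := d) (q := q) (p := p) (a := a) hij hc
  have ij := part_lower_one (d := d) (q := q) (p := p) (a := a) hij.symm hc'
  have Li := IsLow.left (b := b) (d := d) (q := q) (p := p) (a := a) (i := i) (j := j)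
  have Lj := IsLow.right (b := b) (d := d) (q := q) (p := p) (a := a) (i := i) (j := j)
  have si := fun {m n} => string_one (a := a) (m := m) (n := n) hi
  have sj := fun {m n} => string_one (a := a) (m := m) (n := n) hj
  set I := lower b d q p a i
  set J := lower b d q p a j
  refine ⟨[I 1, I 1 + J 2], ?_, ?_, ?_⟩
  · simp only [List.forall_mem_cons, List.not_mem_nil, false_imp_iff, implies_true, and_true]
    exact ⟨Li 1, (Li 1).add (Lj 2)⟩
  · convert add_mem (si (m := Y b i a) (n := 0) hY)
      (mono_mem_invariants d q (i := i) (m := Y b i a + I 1 + J 2) ?_) using 1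
    · simp only [List.map_cons, List.map_nil, List.sum_cons, List.sum_nil, mono_add]
      norm_num
      ring
    · simp only [map_add, hY, ii, ij]
      norm_num
  · convert add_mem (mono_mem_invariants d q (i := j) (m := Y b i a) hY')
      (sj (m := Y b i a + I 1) (n := 1) ?_) using 1
    · simp only [List.map_cons, List.map_nil, List.sum_cons, List.sum_nil, mono_add]
      norm_num
      ring
    · simp only [map_add, hY', ji, zero_add]

end Characters

/-! ### Fundamental q-characters of types B₂ and G₂. -/

section CharactersOfRankTwo

variable {b : P.Base} {d : b.support → ℕ} {q : ℂˣ} {i j : b.support}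

/-- The five-dimensional representation: strings of sizes 2, 1, 2 for the long node i and 1, 3, 1
for the short node j. -/
lemma hasCharacter_B_two_long (hij : i ≠ j) (hc : cartan b j i = -2) (hc' : cartan b i j = -1)
    (hdi : d i = 2) (hdj : d j = 1) (a : ℂˣ) : HasCharacter b d q i j (Y b i a) := by
  have hi : q ^ d i = q ^ (2 : ℤ) := by rw [hdi]; rfl
  have hj : q ^ d j = q ^ (1 : ℤ) := by rw [hdj, pow_one, zpow_one]
  have ii := part_lower_self (a := a) hi
  have jj := part_lower_self (a := a) hj
  have ji := part_lower_two (d := d) (q := q) (a := a) hij hc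
  have ij := part_lower_one (d := d) (q := q) (p := q) (a := a) hij.symm hc'
  have Li := IsLow.left (b := b) (d := d) (q := q) (p := q) (a := a) (i := i) (j := j)
  have Lj := IsLow.right (b := b) (d := d) (q := q) (p := q) (a := a) (i := i) (j := j)
  have hY : part b i (Y b i a) = pt q a 0 := by rw [part_Y_same, pt]; simp
  have hY' : part b j (Y b i a) = 0 := part_Y_ne b hij a
  set I := lower b d q q a i
  set J := lower b d q q a j
  refine ⟨[I 2, I 2 + J 4, I 2 + J 4 + J 2, I 2 + J 4 + J 2 + I 4], ?_, ?_, ?_⟩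
  · simp only [List.forall_mem_cons, List.not_mem_nil, false_imp_iff, implies_true, and_true]
    exact ⟨Li 2,
      (Li 2).add (Lj 4),
      ((Li 2).add (Lj 4)).add (Lj 2),
      (((Li 2).add (Lj 4)).add (Lj 2)).add (Li 4)⟩
  · convert add_mem (string_one (m := Y b i a) (n := 0) hi ?_)
      (add_mem (mono_mem_invariants d q (i := i) (m := Y b i a + I 2 + J 4) ?_)
      (string_one (m := Y b i a + I 2 + J 4 + J 2) (n := 2) hi ?_)) using 1
    · simp only [List.map_cons, List.map_nil, List.sum_cons, List.sum_nil, mono_add]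
      norm_num
      ring
    all_goals
      simp only [map_add, hY, ii, ij] <;>
        norm_num
  · convert add_mem (mono_mem_invariants d q (i := j) (m := Y b i a) ?_)
      (add_mem (string_two (m := Y b i a + I 2) (n := 1) hj ?_)
      (mono_mem_invariants d q (i := j) (m := Y b i a + I 2 + J 4 + J 2 + I 4) ?_)) using 1
    · simp only [List.map_cons, List.map_nil, List.sum_cons, List.sum_nil, mono_add]
      norm_num
      ring
    all_goals
      simp only [map_add, hY', jj, ji] <;>
        norm_num <;> abel

/-- The four-dimensional spin representation: sizes 1, 2, 1 for i and 2, 2 for j. -/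
lemma hasCharacter_B_two_short (hij : i ≠ j) (hc : cartan b j i = -2) (hc' : cartan b i j = -1)
    (hdi : d i = 2) (hdj : d j = 1) (a : ℂˣ) : HasCharacter b d q i j (Y b j a) := by
  have hi : q ^ d i = q ^ (2 : ℤ) := by rw [hdi]; rfl
  have hj : q ^ d j = q ^ (1 : ℤ) := by rw [hdj, pow_one, zpow_one]
  have ii := part_lower_self (a := a) hi
  have jj := part_lower_self (a := a) hj
  have ji := part_lower_two (d := d) (q := q) (a := a) hij hc
  have ij := part_lower_one (d := d) (q := q) (p := q) (a := a) hij.symm hc'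
  have Li := IsLow.left (b := b) (d := d) (q := q) (p := q) (a := a) (i := i) (j := j)
  have Lj := IsLow.right (b := b) (d := d) (q := q) (p := q) (a := a) (i := i) (j := j)
  have hY : part b j (Y b j a) = pt q a 0 := by rw [part_Y_same, pt]; simp
  have hY' : part b i (Y b j a) = 0 := part_Y_ne b hij.symm a
  set I := lower b d q q a i
  set J := lower b d q q a j
  refine ⟨[J 1, J 1 + I 3, J 1 + I 3 + J 5], ?_, ?_, ?_⟩
  · simp only [List.forall_mem_cons, List.not_mem_nil, false_imp_iff, implies_true, and_true]
    exact ⟨Lj 1,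
      (Lj 1).add (Li 3),
      ((Lj 1).add (Li 3)).add (Lj 5)⟩
  · convert add_mem (mono_mem_invariants d q (i := i) (m := Y b j a) ?_)
      (add_mem (string_one (m := Y b j a + J 1) (n := 1) hi ?_)
      (mono_mem_invariants d q (i := i) (m := Y b j a + J 1 + I 3 + J 5) ?_)) using 1
    · simp only [List.map_cons, List.map_nil, List.sum_cons, List.sum_nil, mono_add]
      norm_num
      ring
    all_goals
      simp only [map_add, hY', ii, ij] <;>
        norm_num
  · convert add_mem (string_one (m := Y b j a) (n := 0) hj ?_)
      (string_one (m := Y b j a + J 1 + I 3) (n := 4) hj ?_) using 1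
    · simp only [List.map_cons, List.map_nil, List.sum_cons, List.sum_nil, mono_add]
      norm_num
      ring
    all_goals
      simp only [map_add, hY, jj, ji] <;>
        norm_num

/-- The seven-dimensional representation: sizes 1, 2, 1, 2, 1 for i and 2, 3, 2 for j. -/
lemma hasCharacter_G_two_short (hij : i ≠ j) (hc : cartan b j i = -3) (hc' : cartan b i j = -1)
    (hdi : d i = 3) (hdj : d j = 1) (a : ℂˣ) : HasCharacter b d q i j (Y b j a) := by
  have hi : q ^ d i = q ^ (3 : ℤ) := by rw [hdi]; rfl
  have hj : q ^ d j = q ^ (1 : ℤ) := by rw [hdj, pow_one, zpow_one]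
  have ii := part_lower_self (a := a) hi
  have jj := part_lower_self (a := a) hj
  have ji := part_lower_three (d := d) (q := q) (a := a) hij hc
  have ij := part_lower_one (d := d) (q := q) (p := q) (a := a) hij.symm hc'
  have Li := IsLow.left (b := b) (d := d) (q := q) (p := q) (a := a) (i := i) (j := j)
  have Lj := IsLow.right (b := b) (d := d) (q := q) (p := q) (a := a) (i := i) (j := j)
  have hY : part b j (Y b j a) = pt q a 0 := by rw [part_Y_same, pt]; simp
  have hY' : part b i (Y b j a) = 0 := part_Y_ne b hij.symm a
  set I := lower b d q q a i
  set J := lower b d q q a j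
  refine ⟨[J 1, J 1 + I 4, J 1 + I 4 + J 7, J 1 + I 4 + J 7 + J 5,
    J 1 + I 4 + J 7 + J 5 + I 8, J 1 + I 4 + J 7 + J 5 + I 8 + J 11], ?_, ?_, ?_⟩
  · simp only [List.forall_mem_cons, List.not_mem_nil, false_imp_iff, implies_true, and_true]
    exact ⟨Lj 1,
      (Lj 1).add (Li 4),
      ((Lj 1).add (Li 4)).add (Lj 7),
      (((Lj 1).add (Li 4)).add (Lj 7)).add (Lj 5),
      ((((Lj 1).add (Li 4)).add (Lj 7)).add (Lj 5)).add (Li 8),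
      (((((Lj 1).add (Li 4)).add (Lj 7)).add (Lj 5)).add (Li 8)).add (Lj 11)⟩
  · convert add_mem (mono_mem_invariants d q (i := i) (m := Y b j a) ?_)
      (add_mem (string_one (m := Y b j a + J 1) (n := 1) hi ?_)
      (add_mem (mono_mem_invariants d q (i := i) (m := Y b j a + J 1 + I 4 + J 7) ?_)
      (add_mem (string_one (m := Y b j a + J 1 + I 4 + J 7 + J 5) (n := 5) hi ?_)
      (mono_mem_invariants d q (i := i) (m := Y b j a + J 1 + I 4 + J 7 + J 5 + I 8 + J 11) ?_)))) using 1
    · simp only [List.map_cons, List.map_nil, List.sum_cons, List.sum_nil, mono_add]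
      norm_num
      ring
    all_goals
      simp only [map_add, hY', ii, ij] <;>
        norm_num
  · convert add_mem (string_one (m := Y b j a) (n := 0) hj ?_)
      (add_mem (string_two (m := Y b j a + J 1 + I 4) (n := 4) hj ?_)
      (string_one (m := Y b j a + J 1 + I 4 + J 7 + J 5 + I 8) (n := 10) hj ?_)) using 1
    · simp only [List.map_cons, List.map_nil, List.sum_cons, List.sum_nil, mono_add]
      norm_num
      ring
    all_goals
      simp only [map_add, hY, jj, ji] <;>
        norm_num <;> abel

/-- Here the fundamental representation has dimension 15, the adjoint representation plus a trivial
one. The sizes are 2, 1, 2, 4, 1, 2, 1, 2 for i and 1, 4, 4, 1, 4, 1 for j. The block of size 4 for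
i and the middle one for j are products of two doublets whose parameters are not in the ratio q_i²
or q_j², so nothing splits off. -/
lemma hasCharacter_G_two_long (hij : i ≠ j) (hc : cartan b j i = -3) (hc' : cartan b i j = -1)
    (hdi : d i = 3) (hdj : d j = 1) (a : ℂˣ) : HasCharacter b d q i j (Y b i a) := by
  have hi : q ^ d i = q ^ (3 : ℤ) := by rw [hdi]; rfl
  have hj : q ^ d j = q ^ (1 : ℤ) := by rw [hdj, pow_one, zpow_one]
  have ii := part_lower_self (a := a) hi
  have jj := part_lower_self (a := a) hj
  have ji := part_lower_three (d := d) (q := q) (a := a) hij hc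
  have ij := part_lower_one (d := d) (q := q) (p := q) (a := a) hij.symm hc'
  have Li := IsLow.left (b := b) (d := d) (q := q) (p := q) (a := a) (i := i) (j := j)
  have Lj := IsLow.right (b := b) (d := d) (q := q) (p := q) (a := a) (i := i) (j := j)
  have hY : part b i (Y b i a) = pt q a 0 := by rw [part_Y_same, pt]; simp
  have hY' : part b j (Y b i a) = 0 := part_Y_ne b hij a
  set I := lower b d q q a i
  set J := lower b d q q a j
  refine ⟨[I 3, I 3 + J 6, I 3 + J 6 + J 4, I 3 + J 6 + J 4 + J 2,
    I 3 + J 6 + J 4 + I 7, I 3 + J 6 + J 4 + I 7 + J 2, I 3 + J 6 + J 4 + J 2 + I 5, I 3 + J 6 + J 4 + I 7 + J 10,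
    I 3 + J 6 + J 4 + I 7 + J 2 + I 5, I 3 + J 6 + J 4 + I 7 + J 2 + J 10, I 3 + J 6 + J 4 + I 7 + J 2 + I 5 + J 10, I 3 + J 6 + J 4 + I 7 + J 2 + I 5 + J 10 + J 8,
    I 3 + J 6 + J 4 + I 7 + J 2 + I 5 + J 10 + J 8 + J 6, I 3 + J 6 + J 4 + I 7 + J 2 + I 5 + J 10 + J 8 + J 6 + I 9], ?_, ?_, ?_⟩
  · simp only [List.forall_mem_cons, List.not_mem_nil, false_imp_iff, implies_true, and_true]
    exact ⟨Li 3,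
      (Li 3).add (Lj 6),
      ((Li 3).add (Lj 6)).add (Lj 4),
      (((Li 3).add (Lj 6)).add (Lj 4)).add (Lj 2),
      (((Li 3).add (Lj 6)).add (Lj 4)).add (Li 7),
      ((((Li 3).add (Lj 6)).add (Lj 4)).add (Li 7)).add (Lj 2),
      ((((Li 3).add (Lj 6)).add (Lj 4)).add (Lj 2)).add (Li 5),
      ((((Li 3).add (Lj 6)).add (Lj 4)).add (Li 7)).add (Lj 10),
      (((((Li 3).add (Lj 6)).add (Lj 4)).add (Li 7)).add (Lj 2)).add (Li 5),
      (((((Li 3).add (Lj 6)).add (Lj 4)).add (Li 7)).add (Lj 2)).add (Lj 10),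
      ((((((Li 3).add (Lj 6)).add (Lj 4)).add (Li 7)).add (Lj 2)).add (Li 5)).add (Lj 10),
      (((((((Li 3).add (Lj 6)).add (Lj 4)).add (Li 7)).add (Lj 2)).add (Li 5)).add (Lj 10)).add (Lj 8),
      ((((((((Li 3).add (Lj 6)).add (Lj 4)).add (Li 7)).add (Lj 2)).add (Li 5)).add (Lj 10)).add (Lj 8)).add (Lj 6),
      (((((((((Li 3).add (Lj 6)).add (Lj 4)).add (Li 7)).add (Lj 2)).add (Li 5)).add (Lj 10)).add (Lj 8)).add (Lj 6)).add (Li 9)⟩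
  · convert add_mem (string_one (m := Y b i a) (n := 0) hi ?_)
      (add_mem (mono_mem_invariants d q (i := i) (m := Y b i a + I 3 + J 6) ?_)
      (add_mem (string_one (m := Y b i a + I 3 + J 6 + J 4) (n := 4) hi ?_)
      (add_mem (string_pair (m := Y b i a + I 3 + J 6 + J 4 + J 2) (n := 2) (n' := 4) hi ?_)
      (add_mem (mono_mem_invariants d q (i := i) (m := Y b i a + I 3 + J 6 + J 4 + I 7 + J 10) ?_)
      (add_mem (string_one (m := Y b i a + I 3 + J 6 + J 4 + I 7 + J 2 + J 10) (n := 2) hi ?_)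
      (add_mem (mono_mem_invariants d q (i := i) (m := Y b i a + I 3 + J 6 + J 4 + I 7 + J 2 + I 5 + J 10 + J 8) ?_)
      (string_one (m := Y b i a + I 3 + J 6 + J 4 + I 7 + J 2 + I 5 + J 10 + J 8 + J 6) (n := 6) hi ?_))))))) using 1
    · simp only [List.map_cons, List.map_nil, List.sum_cons, List.sum_nil, mono_add]
      norm_num
      ring
    all_goals
      simp only [map_add, hY, ii, ij] <;>
        norm_num <;> abel
  · convert add_mem (mono_mem_invariants d q (i := j) (m := Y b i a) ?_)
      (add_mem (string_three (m := Y b i a + I 3) (n := 1) hj ?_)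
      (add_mem (string_pair (m := Y b i a + I 3 + J 6 + J 4 + I 7) (n := 1) (n' := 9) hj ?_)
      (add_mem (mono_mem_invariants d q (i := j) (m := Y b i a + I 3 + J 6 + J 4 + J 2 + I 5) ?_)
      (add_mem (string_three (m := Y b i a + I 3 + J 6 + J 4 + I 7 + J 2 + I 5) (n := 5) hj ?_)
      (mono_mem_invariants d q (i := j) (m := Y b i a + I 3 + J 6 + J 4 + I 7 + J 2 + I 5 + J 10 + J 8 + J 6 + I 9) ?_))))) using 1
    · simp only [List.map_cons, List.map_nil, List.sum_cons, List.sum_nil, mono_add]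
      norm_num
      ring
    all_goals
      simp only [map_add, hY', jj, ji] <;>
        norm_num <;> abel

end CharactersOfRankTwo

/-! ### Cartan matrix entries and root lengths -/

lemma cartan_cases (b : P.Base) {i j : b.support} (hij : i ≠ j) :
    (cartan b j i = 0 ∧ cartan b i j = 0) ∨ (cartan b j i = -1 ∧ cartan b i j = -1) ∨
    (cartan b j i = -2 ∧ cartan b i j = -1) ∨ (cartan b j i = -1 ∧ cartan b i j = -2) ∨
    (cartan b j i = -3 ∧ cartan b i j = -1) ∨ (cartan b j i = -1 ∧ cartan b i j = -3) := by
  have hne : (i : ι) ≠ j := fun h => hij (Subtype.ext h)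
  have h1 := P.pairingIn_pairingIn_mem_set_of_isCrystal_of_isRed' i j
    (fun h => hne (P.root.injective h)) (b.root_ne_neg_of_ne i.2 j.2 hne)
  have h2 := b.cartanMatrix_le_zero_of_ne i j hij
  have h3 := b.cartanMatrix_le_zero_of_ne j i hij.symm
  change P.pairingIn ℤ i j ≤ 0 at h2
  change P.pairingIn ℤ j i ≤ 0 at h3
  simp only [cartan]
  simp only [Set.mem_insert_iff, Set.mem_singleton_iff, Prod.mk.injEq, Prod.mk_zero_zero,
    Prod.mk_eq_zero, Prod.mk_one_one, Prod.mk_eq_one] at h1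
  omega

section Lengths

variable [P.IsIrreducible] {b : P.Base} {d : b.support → ℕ}

/-- The symmetrizing integers are proportional to the squared lengths of the simple roots. -/
lemma symmetrizer_mul_form (B : P.InvariantForm) (hpos : ∀ i, 0 < d i)
    (hsymm : ∀ i j, (d i : ℤ) * cartan b i j = (d j : ℤ) * cartan b j i) (i j : b.support) :
    (d i : ℂ) * B.form (P.root j) (P.root j) = d j * B.form (P.root i) (P.root i) := by
  -- Both quantities symmetrize the Cartan matrix, so their ratio is constant along edges;
  -- irreducibility makes the Dynkin diagram connected.
  refine b.induction_on_cartanMatrix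
    (fun k => (d i : ℂ) * B.form (P.root k) (P.root k) = d k * B.form (P.root i) (P.root i))
    (i := i) rfl (fun k l hk hlk => ?_)
  have hd : (d k : ℂ) ≠ 0 := Nat.cast_ne_zero.2 (hpos k).ne'
  have h1 := B.pairing_mul_eq_pairing_mul_swap (k : ι) (l : ι)
  have h2 : (d k : ℂ) * P.pairing l k = d l * P.pairing k l := by
    have := congrArg (algebraMap ℤ ℂ) (hsymm k l)
    rw [map_mul, map_mul, cartan, cartan, P.algebraMap_pairingIn, P.algebraMap_pairingIn] at this
    simpa using this
  have h3 : P.pairing l k ≠ 0 := fun h => hlk (b.cartanMatrix_apply_eq_zero_iff_pairing.2 h)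
  have h4 : (d k : ℂ) * B.form (P.root l) (P.root l) = d l * B.form (P.root k) (P.root k) := by
    refine mul_left_cancel₀ h3 ?_
    linear_combination B.form (P.root l) (P.root l) * h2 - (d l : ℂ) * h1
  refine mul_left_cancel₀ hd ?_
  linear_combination (d i : ℂ) * h4 + (d l : ℂ) * hk

/-- On a multiple edge A_{i,a} is written with q itself and not with q_j, so the B₂ and G₂
characters need d_j = 1. This comes from coprimality together with the fact that only two root
lengths occur. -/
lemma symmetrizer_eq {c : ℕ} (hc : 2 ≤ c) (hpos : ∀ i, 0 < d i)
    (hsymm : ∀ i j, (d i : ℤ) * cartan b i j = (d j : ℤ) * cartan b j i)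
    (hgcd : Finset.univ.gcd d = 1) {i j : b.support} (h : cartan b j i = -c)
    (h' : cartan b i j = -1) : d i = c ∧ d j = 1 := by
  have hij : d i = c * d j := by
    have := hsymm i j
    rw [h, h'] at this
    have h2 : (d i : ℤ) = c * d j := by linear_combination -this
    exact_mod_cast h2
  let _ := Fintype.ofFinite ι
  let B := P.toInvariantForm
  have hprop := symmetrizer_mul_form B hpos hsymm
  have hBne : ∀ k, B.form (P.root k) (P.root k) ≠ 0 := B.ne_zero
  have hdne : ∀ k, (d k : ℂ) ≠ 0 := fun k => Nat.cast_ne_zero.2 (hpos k).ne'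
  have hinj : ∀ k l : b.support,
      B.form (P.root k) (P.root k) = B.form (P.root l) (P.root l) ↔ d k = d l := by
    intro k l
    have h1 := hprop k l
    constructor
    · intro h2
      rw [h2] at h1
      exact_mod_cast mul_right_cancel₀ (hBne l) h1
    · intro h2
      rw [h2] at h1
      exact (mul_left_cancel₀ (hdne l) h1).symm
  have hne : B.form (P.root i) (P.root i) ≠ B.form (P.root j) (P.root j) := by
    rw [Ne, hinj, hij]
    have := hpos j
    nlinarith
  -- Every simple root has the length of α_i or of α_j, so each d_k is c d_j or d_j.
  have hdvd : ∀ k, d j ∣ d k := by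
    intro k
    rcases B.apply_eq_or_of_apply_ne hne k with h1 | h1
    · rw [(hinj k i).1 h1, hij]
      exact Dvd.intro_left c rfl
    · rw [(hinj k j).1 h1]
  have h1 : d j = 1 := Nat.dvd_one.1 (hgcd ▸ Finset.dvd_gcd fun k _ => hdvd k)
  exact ⟨by rw [hij, h1, mul_one], h1⟩

/-- Rank two fundamental characters. -/
theorem hasCharacter (q : ℂˣ) (hpos : ∀ i, 0 < d i)
    (hsymm : ∀ i j, (d i : ℤ) * cartan b i j = (d j : ℤ) * cartan b j i)
    (hgcd : Finset.univ.gcd d = 1) {i j : b.support} (hij : i ≠ j) (a : ℂˣ) :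
    HasCharacter b d q i j (Y b i a) := by
  rcases cartan_cases b hij with ⟨h, h'⟩ | ⟨h, h'⟩ | ⟨h, h'⟩ | ⟨h, h'⟩ | ⟨h, h'⟩ | ⟨h, h'⟩
  · exact hasCharacter_of_cartan_eq_zero hij h a
  · refine hasCharacter_A_two hij h h' ?_ a
    have := hsymm i j
    rw [h, h'] at this
    omega
  · obtain ⟨h1, h2⟩ := symmetrizer_eq (c := 2) le_rfl hpos hsymm hgcd h h'
    exact hasCharacter_B_two_long hij h h' h1 h2 a
  · obtain ⟨h1, h2⟩ := symmetrizer_eq (c := 2) le_rfl hpos hsymm hgcd h' h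
    exact (hasCharacter_B_two_short hij.symm h' h h1 h2 a).symm
  · obtain ⟨h1, h2⟩ := symmetrizer_eq (c := 3) (by norm_num) hpos hsymm hgcd h h'
    exact hasCharacter_G_two_long hij h h' h1 h2 a
  · obtain ⟨h1, h2⟩ := symmetrizer_eq (c := 3) (by norm_num) hpos hsymm hgcd h' h
    exact (hasCharacter_G_two_short hij.symm h' h h1 h2 a).symm

/-! ### The rank two relations -/

lemma isTwisted_word (b : P.Base) (d : b.support → ℕ) (q : ℂˣ) (p : List b.support) :
    IsTwisted b (wordProd b p) (p.map (thetaHom b d q)).prod := by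
  induction p with
  | nil => exact IsTwisted.one b
  | cons i p ih =>
    rw [wordProd_cons, List.map_cons, List.prod_cons]
    exact (isTwisted_thetaHom b d q i).comp ih

lemma word_apply_of_mem_invariants {q : ℂˣ} {i j : b.support} {p : List b.support}
    (hp : ∀ k ∈ p, k = i ∨ k = j) {x : BigPi b} (hi : x ∈ invariants b d q i)
    (hj : x ∈ invariants b d q j) : (p.map (thetaHom b d q)).prod x = x := by
  induction p with
  | nil => rfl
  | cons k p ih =>
    rw [List.map_cons, List.prod_cons, RingHom.mul_def, RingHom.comp_apply,
      ih fun l hl => hp l (List.mem_cons_of_mem _ hl)]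
    rcases hp k List.mem_cons_self with rfl | rfl
    exacts [hi, hj]

/-- At a minimal `v` both v(α_i) and v(α_j) are positive, so the rank two characters have leading
monomials Y_{i,a} and Y_{j,a}. With the other variables, fixed by both operators, these generate all
monomials and rigidity applies. -/
lemma word_apply_of_isMinimal (q : ℂˣ) (hpos : ∀ i, 0 < d i)
    (hsymm : ∀ i j, (d i : ℤ) * cartan b i j = (d j : ℤ) * cartan b j i)
    (hgcd : Finset.univ.gcd d = 1) {i j : b.support} (hij : i ≠ j) {p : List b.support}
    (hp : ∀ k ∈ p, k = i ∨ k = j) (h1 : wordProd b p = 1) {v : P.weylGroup}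
    (hv : IsMinimal b i j v) (x : BigPi b) : (p.map (thetaHom b d q)).prod x v = x v := by
  have hF := isTwisted_word b d q p
  rw [h1] at hF
  refine hF.eq_of_generators _ (closure_Y_eq_top b) ?_ x
  have hchar : ∀ m, HasCharacter b d q i j m → ∃ R : List (Mono b),
      (∀ r ∈ R, monomial b v r ∈ heightFiltration b v 1) ∧
      (p.map (thetaHom b d q)).prod (mono b m * (1 + (R.map (mono b)).sum)) =
        mono b m * (1 + (R.map (mono b)).sum) := by
    rintro m ⟨R, hR, hRi, hRj⟩
    exact ⟨R, fun r hr => hR r hr v hv, word_apply_of_mem_invariants hp hRi hRj⟩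
  rintro _ ⟨⟨k, a⟩, rfl⟩
  by_cases hki : k = i
  · subst hki
    exact hchar _ (hasCharacter q hpos hsymm hgcd hij a)
  by_cases hkj : k = j
  · subst hkj
    exact hchar _ (hasCharacter q hpos hsymm hgcd hij.symm a).symm
  · refine ⟨[], by simp, ?_⟩
    simpa using word_apply_of_mem_invariants hp
      (mono_mem_invariants d q (part_Y_ne b hki a)) (mono_mem_invariants d q (part_Y_ne b hkj a))

/-- The operators `Θ_i` and `Θ_j` satisfy all relations between `s_i` and `s_j`. -/
theorem rank_two_relations (q : ℂˣ) (hpos : ∀ i, 0 < d i)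
    (hsymm : ∀ i j, (d i : ℤ) * cartan b i j = (d j : ℤ) * cartan b j i)
    (hgcd : Finset.univ.gcd d = 1) {i j : b.support} (hij : i ≠ j) {p : List b.support}
    (hp : ∀ k ∈ p, k = i ∨ k = j) (h1 : wordProd b p = 1) :
    (p.map (thetaHom b d q)).prod = 1 := by
  ext1 x
  funext v
  obtain ⟨r, hr, hmin⟩ := exists_isMinimal b i j v
  set θ := thetaHom b d q with hθ
  have hinv : (r.map θ).prod * (r.reverse.map θ).prod = 1 :=
    prod_mul_prod_reverse (thetaHom_mul_self b d q) r
  -- The conjugate of `p` that moves the question from `v` to the minimal element v · `wordProd b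
  -- r`.
  set c := r.reverse ++ (p ++ r) with hc
  have hcmem : ∀ k ∈ c, k = i ∨ k = j := by
    intro k hk
    simp only [hc, List.mem_append, List.mem_reverse] at hk
    rcases hk with hk | hk | hk
    exacts [hr k hk, hp k hk, hr k hk]
  have hc1 : wordProd b c = 1 := by
    rw [hc, wordProd_append, wordProd_append, h1, one_mul, wordProd_reverse, inv_mul_cancel]
  have hG := word_apply_of_isMinimal q hpos hsymm hgcd hij hcmem hc1 hmin ((r.reverse.map θ).prod x)
  -- At `v`, the operator of the word `r` sees only the component at the minimal element, where `c`
  -- acts trivially.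
  have h2 := (isTwisted_word b d q r).congr hG
  have h3 : (r.map θ).prod * ((c.map θ).prod * (r.reverse.map θ).prod) = (p.map θ).prod := by
    rw [hc, List.map_append, List.prod_append, List.map_append, List.prod_append, mul_assoc,
      mul_assoc, hinv, mul_one, ← mul_assoc, hinv, one_mul]
  calc (p.map θ).prod x v = ((r.map θ).prod * ((c.map θ).prod * (r.reverse.map θ).prod)) x v := by
        rw [h3]
    _ = ((r.map θ).prod * (r.reverse.map θ).prod) x v := h2
    _ = x v := by rw [hinv]; rfl

/-! ### The action of the Weyl group -/

lemma nontrivial_completion (b : P.Base) (w : P.weylGroup) : (1 : Completion b w) ≠ 0 := by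
  intro h
  have := congrArg (fun x : Completion b w => x.coeff 0) h
  simp [coeff_one, coeff_zero] at this

/-- The operators `Θ_i` define a faithful action of the Weyl group by ring automorphisms. -/
theorem exists_weylGroup_action (q : ℂˣ) (hpos : ∀ i, 0 < d i)
    (hsymm : ∀ i j, (d i : ℤ) * cartan b i j = (d j : ℤ) * cartan b j i)
    (hgcd : Finset.univ.gcd d = 1) :
    ∃ ρ : P.weylGroup →* RingAut (BigPi b),
      (∀ i x, ρ (simpleRefl b i) x = Theta b d q i x) ∧ Function.Injective ρ := by
  obtain ⟨φ, hφ⟩ := exists_monoidHom_of_rank_two (b := b) (θ := thetaHom b d q)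
    (thetaHom_mul_self b d q)
    fun i j hij p hp h1 => rank_two_relations q hpos hsymm hgcd hij hp h1
  have hcancel : ∀ g h : P.weylGroup, g * h = 1 → ∀ x, φ g (φ h x) = x := by
    intro g h e x
    have := congrArg φ e
    rw [map_mul, map_one] at this
    exact RingHom.congr_fun this x
  let ρ : P.weylGroup →* RingAut (BigPi b) :=
    { toFun := fun g =>
        { toFun := φ g
          invFun := φ g⁻¹
          left_inv := hcancel _ _ (inv_mul_cancel g)
          right_inv := hcancel _ _ (mul_inv_cancel g)
          map_mul' := map_mul _
          map_add' := map_add _ }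
      map_one' := by
        ext1 x
        exact RingHom.congr_fun (map_one φ) x
      map_mul' := fun g h => by
        ext1 x
        exact RingHom.congr_fun (map_mul φ g h) x }
  have hρ : ∀ g x, ρ g x = φ g x := fun _ _ => rfl
  refine ⟨ρ, fun i x => by rw [hρ, hφ]; rfl, ?_⟩
  rw [injective_iff_map_eq_one]
  intro g hg
  have htw : IsTwisted b g (φ g) := by
    obtain ⟨l, rfl⟩ := exists_word b g
    have := isTwisted_word b d q l
    rw [wordProd, map_list_prod, List.map_map]
    rwa [show (φ ∘ simpleRefl b : b.support → _) = thetaHom b d q from funext hφ]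
  by_contra hne
  -- The image under `g` at the component of 1 depends only on the component at `g`. The idempotent
  -- supported at 1 vanishes there if g ≠ 1, so `g` cannot act as the identity.
  have h1 : φ g (Pi.single 1 1) 1 = φ g 0 1 := htw.congr (by
    rw [one_mul, Pi.single_eq_of_ne hne, Pi.zero_apply])
  rw [← hρ, ← hρ, hg] at h1
  have h2 : (Pi.single 1 1 : BigPi b) 1 = (0 : BigPi b) 1 := h1
  rw [Pi.single_eq_same, Pi.zero_apply] at h2
  exact nontrivial_completion b 1 h2

end Lengths

end

end QWeyl

/-- The Lie algebra enters only through its root system, which is finite, crystallographic, reduced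
and, by simplicity, irreducible. -/
theorem mainTheorem7 {𝔤 : Type*} [LieRing 𝔤] [LieAlgebra ℂ 𝔤] [FiniteDimensional ℂ 𝔤]
    [LieAlgebra.IsSimple ℂ 𝔤] (H : LieSubalgebra ℂ 𝔤) [H.IsCartanSubalgebra]
    (b : (LieAlgebra.IsKilling.rootSystem H).Base)
    (d : b.support → ℕ) (hd_pos : ∀ i, 0 < d i)
    (hd_symm : ∀ i j, (d i : ℤ) * QWeyl.cartan b i j = (d j : ℤ) * QWeyl.cartan b j i)
    (hd_gcd : Finset.univ.gcd d = 1)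
    (q : ℂˣ) (hq : ∀ n : ℕ, 0 < n → q ^ n ≠ 1) :
    ∃ ρ : (LieAlgebra.IsKilling.rootSystem H).weylGroup →* RingAut (QWeyl.BigPi b),
      (∀ i x, ρ (QWeyl.simpleRefl b i) x = QWeyl.Theta b d q i x) ∧
        Function.Injective ρ := by
  exact QWeyl.exists_weylGroup_action q hd_pos hd_symm hd_gcd
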